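/- Let $\mathbf k=\mathbb C(q^{1/4},t^{1/4})$, where $q^{1/4},t^{1/4}$ are independent variables. Call $(j_1,j_2,j_3)\in\mathbb Z^3$ admissible if $j_1,j_2,j_3\ge 0$, $|j_1-j_2|\le j_3\le j_1+j_2$ and $j_1+j_2+j_3$ is even. Put $$[n,m]_{q,t}=\frac{q^{n/2}t^{m/2}-q^{-n/2}t^{-m/2}}{q^{1/2}-q^{-1/2}},$$ $$C_{a,b}(j_1,j_2,j_3)=ab\,\frac{\left[\frac{aj_1+bj_2+j_3}{2},\frac{a+b+2}{2}\right]_{q,t}\left[\frac{aj_1+bj_2-j_3}{2},\frac{a+b}{2}\right]_{q,t}[j_1-1,2]_{q,t}\,[j_2-1,2]_{q,t}}{\left[j_1,\frac{a+3}{2}\right]_{q,t}\left[j_1-1,\frac{a+3}{2}\right]_{q,t}\left[j_2,\frac{b+3}{2}\right]_{q,t}\left[j_2-1,\frac{b+3}{2}\right]_{q,t}}.$$ The genus two Macdonald polynomials are the Laurent polynomials $\Psi_{j_1,j_2,j_3}$, $(j_1,j_2,j_3)\in\mathbb Z^3$, in $x_{12},x_{13},x_{23}$ over $\mathbf k$ with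 $\Psi_{0,0,0}=1$, $\Psi_{j_1,j_2,j_3}=0$ for non-admissible triples, and, for every admissible triple, $$(x_{12}+x_{12}^{-1})\Psi_{j_1,j_2,j_3}=\sum_{a,b\in\{\pm1\}}C_{a,b}(j_1,j_2,j_3)\Psi_{j_1+a,j_2+b,j_3},$$ $$(x_{13}+x_{13}^{-1})\Psi_{j_1,j_2,j_3}=\sum_{a,b\in\{\pm1\}}C_{a,b}(j_1,j_3,j_2)\Psi_{j_1+a,j_2,j_3+b},$$ $$(x_{23}+x_{23}^{-1})\Psi_{j_1,j_2,j_3}=\sum_{a,b\in\{\pm1\}}C_{a,b}(j_2,j_3,j_1)\Psi_{j_1,j_2+a,j_3+b}.$$ Let $\hat\delta_{12}$ be the automorphism of $\mathbf k(x_{12},x_{13},x_{23})$ over $\mathbf k$ with $x_{12}\mapsto q^{1/2}x_{12}$ that fixes $x_{13},x_{23}$, and similarly $\hat\delta_{13},\hat\delta_{23}$. Define operators on $\mathbf k(x_{12},x_{13},x_{23})$ by $$\hat{\mathcal O}_{A_1}=\sum_{a,b\in\{\pm1\}}ab\,\frac{(1-t^{1/2}x_{23}x_{12}^ax_{13}^b)(1-t^{1/2}x_{23}^{-1}x_{12}^ax_{13}^b)}{t^{1/2}x_{12}^ax_{13}^b(x_{12}-x_{12}^{-1})(x_{13}-x_{13}^{-1})}\,\hat\delta_{12}^a\hat\delta_{13}^b,$$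 $$\hat{\mathcal O}_{A_2}=\sum_{a,b\in\{\pm1\}}ab\,\frac{(1-t^{1/2}x_{13}x_{12}^ax_{23}^b)(1-t^{1/2}x_{13}^{-1}x_{12}^ax_{23}^b)}{t^{1/2}x_{12}^ax_{23}^b(x_{12}-x_{12}^{-1})(x_{23}-x_{23}^{-1})}\,\hat\delta_{12}^a\hat\delta_{23}^b,$$ $$\hat{\mathcal O}_{A_3}=\sum_{a,b\in\{\pm1\}}ab\,\frac{(1-t^{1/2}x_{12}x_{13}^ax_{23}^b)(1-t^{1/2}x_{12}^{-1}x_{13}^ax_{23}^b)}{t^{1/2}x_{13}^ax_{23}^b(x_{13}-x_{13}^{-1})(x_{23}-x_{23}^{-1})}\,\hat\delta_{13}^a\hat\delta_{23}^b,$$ and let $\hat{\mathcal O}_{B_{ij}}$ be multiplication by $x_{ij}+x_{ij}^{-1}$. Let $\mathcal A$ be the $\mathbf k$-algebra of operators generated by these six operators (the algebra of genus two knot operators), and let $\mathcal H$ be the space of Laurent polynomials in $x_{12},x_{13},x_{23}$ over $\mathbf k$ that are invariant under all inversions $(x_{12},x_{13},x_{23})\mapsto(x_{12}^u,x_{13}^v,x_{23}^w)$,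 $u,v,w\in\{\pm1\}$. Then: 1. The family of genus two Macdonald polynomials $\Psi_{j_1,j_2,j_3}$ exists and is unique. 2. For every admissible triple, $\Psi_{j_1,j_2,j_3}\ne0$ and $$\hat{\mathcal O}_{A_k}\Psi_{j_1,j_2,j_3}=\left(q^{j_k/2}t^{1/2}+q^{-j_k/2}t^{-1/2}\right)\Psi_{j_1,j_2,j_3},\qquad k=1,2,3.$$ 3. The algebra of knot operators acts on $\mathcal H$: $T(\mathcal H)\subseteq\mathcal H$ for every $T\in\mathcal A$. -/

import Mathlib

noncomputable section

namespace GenusTwo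

/-- The ground field `k = ℂ(q^{1/4}, t^{1/4})`, rational functions in two variables. -/
abbrev GroundField : Type := FractionRing (MvPolynomial (Fin 2) ℂ)

/-- The variable `q^{1/4}` of the ground field, so that `q^{n/4} = q4 ^ n`. -/
def q4 : GroundField := algebraMap (MvPolynomial (Fin 2) ℂ) GroundField (MvPolynomial.X 0)

/-- The variable `t^{1/4}` of the ground field, so that `t^{n/4} = t4 ^ n`. -/
def t4 : GroundField := algebraMap (MvPolynomial (Fin 2) ℂ) GroundField (MvPolynomial.X 1)

theorem q4_ne_zero : q4 ≠ 0 := by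
  simp [q4]

/-! The three variables `x₁₂, x₁₃, x₂₃` are indexed by `0, 1, 2 : Fin 3`, in this order. -/

/-- Laurent polynomials over `k` in `x₁₂, x₁₃, x₂₃`: the group algebra of `ℤ³`, in which
`single m 1` is the monomial `x₁₂^{m 0} x₁₃^{m 1} x₂₃^{m 2}`. -/
abbrev Laurent : Type := AddMonoidAlgebra GroundField (Fin 3 → ℤ)

/-- The field `k(x₁₂, x₁₃, x₂₃)` of rational functions: the fraction field of the ring of Laurent
polynomials. -/
abbrev RatFun : Type := FractionRing Laurent

/-- The Laurent monomial `x_i ^ n`. -/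
def xpow (i : Fin 3) (n : ℤ) : Laurent := AddMonoidAlgebra.single (Pi.single i n) 1

/-- The Laurent polynomial `x_i + x_i⁻¹`. -/
def xsym (i : Fin 3) : Laurent := xpow i 1 + xpow i (-1)

/-- The variable `x_i` as a rational function. -/
def x (i : Fin 3) : RatFun := algebraMap Laurent RatFun (xpow i 1)

/-- The embedding of Laurent polynomials into rational functions. -/
def toRatFun : Laurent →ₐ[GroundField] RatFun :=
  IsScalarTower.toAlgHom GroundField Laurent RatFun

/-! ### Symmetric Laurent polynomials -/

/-- The Weyl inversion `x_i ↦ x_i ^ {u i}`, for signs `u i = ±1`. -/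
def inversion (u : Fin 3 → ℤˣ) : Laurent →ₐ[GroundField] Laurent :=
  AddMonoidAlgebra.mapDomainAlgHom GroundField GroundField
    { toFun := fun m i => (u i : ℤ) * m i
      map_zero' := by ext i; simp
      map_add' := fun m n => by ext i; simp [mul_add] }

/-- The space `ℋ` of the Laurent polynomials that are invariant under the group `ℤ₂³` of Weyl
inversions. -/
def symLaurent : Submodule GroundField Laurent where
  carrier := {f | ∀ u : Fin 3 → ℤˣ, inversion u f = f}
  zero_mem' := fun u => map_zero _
  add_mem' := fun {f g} hf hg u => by rw [map_add, hf u, hg u]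
  smul_mem' := fun c f hf u => by rw [map_smul, hf u]

/-- The space `ℋ` as a subspace of `k(x₁₂, x₁₃, x₂₃)`. -/
def symRatFun : Submodule GroundField RatFun := symLaurent.map toRatFun.toLinearMap

/-! ### Shift operators -/

/-- The substitution `x_i ↦ c x_i` (the other variables being fixed) in Laurent polynomials. -/
def dilateHom (i : Fin 3) (c : GroundFieldˣ) : Laurent →ₐ[GroundField] Laurent :=
  AddMonoidAlgebra.lift GroundField Laurent (Fin 3 → ℤ)
    { toFun := fun m => AddMonoidAlgebra.single m.toAdd ((c ^ (m.toAdd i) : GroundFieldˣ) : GroundField)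
      map_one' := by simp [AddMonoidAlgebra.one_def]
      map_mul' := fun m n => by
        simp [AddMonoidAlgebra.single_mul_single, zpow_add] }

theorem dilateHom_single (i : Fin 3) (c : GroundFieldˣ) (m : Fin 3 → ℤ) (r : GroundField) :
    dilateHom i c (AddMonoidAlgebra.single m r) =
      AddMonoidAlgebra.single m (r * ((c ^ (m i) : GroundFieldˣ) : GroundField)) := by
  simp [dilateHom]

theorem dilateHom_comp_inv (i : Fin 3) (c : GroundFieldˣ) :
    (dilateHom i c).comp (dilateHom i c⁻¹) = AlgHom.id GroundField Laurent := by
  apply AddMonoidAlgebra.algHom_ext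
  · intro m
    simp only [AlgHom.comp_apply, dilateHom_single, AlgHom.id_apply]
    congr 1
    rw [one_mul, ← Units.val_mul, inv_zpow, inv_mul_cancel, Units.val_one]
  · exact Subsingleton.elim _ _

/-- The substitution `x_i ↦ c x_i` as an automorphism of the ring of Laurent polynomials. -/
def dilate (i : Fin 3) (c : GroundFieldˣ) : Laurent ≃ₐ[GroundField] Laurent :=
  AlgEquiv.ofAlgHom (dilateHom i c) (dilateHom i c⁻¹) (dilateHom_comp_inv i c)
    (by simpa using dilateHom_comp_inv i c⁻¹)

/-- The shift `δ_i` of `k(x₁₂, x₁₃, x₂₃)`: the automorphism over `k` with `x_i ↦ q^{1/2} x_i` that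
fixes the other two variables. -/
def shift (i : Fin 3) : RatFun ≃ₐ[GroundField] RatFun :=
  IsFractionRing.algEquivOfAlgEquiv (dilate i (Units.mk0 (q4 ^ 2) (pow_ne_zero 2 q4_ne_zero)))

/-! ### The six knot operators -/

/-- The coefficient of `δ_u^a δ_v^b` in the operator with shifted variables `x_u, x_v` and
spectator variable `x_w`. -/
def opCoeff (u v w : Fin 3) (a b : ℤ) : RatFun :=
  let s : RatFun := algebraMap GroundField RatFun (t4 ^ 2)
  ((a * b : ℤ) : RatFun) *
    ((1 - s * x w * x u ^ a * x v ^ b) * (1 - s * (x w)⁻¹ * x u ^ a * x v ^ b)) /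
    (s * x u ^ a * x v ^ b * (x u - (x u)⁻¹) * (x v - (x v)⁻¹))

/-- The `q`-difference operator `∑_{a, b = ±1} opCoeff u v w a b · δ_u^a δ_v^b`. -/
def diffOp (u v w : Fin 3) : Module.End GroundField RatFun :=
  ∑ a ∈ ({-1, 1} : Finset ℤ), ∑ b ∈ ({-1, 1} : Finset ℤ),
    LinearMap.mulLeft GroundField (opCoeff u v w a b) ∘ₗ
      (shift u ^ a * shift v ^ b : RatFun ≃ₐ[GroundField] RatFun).toLinearMap

/-- The operator `O_{A₁}`: it shifts `x₁₂, x₁₃`. -/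
def opA1 : Module.End GroundField RatFun := diffOp 0 1 2

/-- The operator `O_{A₂}`: it shifts `x₁₂, x₂₃`. -/
def opA2 : Module.End GroundField RatFun := diffOp 0 2 1

/-- The operator `O_{A₃}`: it shifts `x₁₃, x₂₃`. -/
def opA3 : Module.End GroundField RatFun := diffOp 1 2 0

/-- The operators `O_{B₁₂}, O_{B₁₃}, O_{B₂₃}` (for `i = 0, 1, 2`) of multiplication by
`x_i + x_i⁻¹`. -/
def opB (i : Fin 3) : Module.End GroundField RatFun :=
  LinearMap.mulLeft GroundField (x i + (x i)⁻¹)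

/-- The algebra of genus two knot operators: the `k`-algebra of `q`-difference operators on
`k(x₁₂, x₁₃, x₂₃)` generated by the six operators. -/
def knotAlgebra : Subalgebra GroundField (Module.End GroundField RatFun) :=
  Algebra.adjoin GroundField {opA1, opA2, opA3, opB 0, opB 1, opB 2}

/-! ### Genus two Macdonald polynomials -/

/-- Admissible triples. -/
def Admissible (j₁ j₂ j₃ : ℤ) : Prop :=
  0 ≤ j₁ ∧ 0 ≤ j₂ ∧ 0 ≤ j₃ ∧ |j₁ - j₂| ≤ j₃ ∧ j₃ ≤ j₁ + j₂ ∧ Even (j₁ + j₂ + j₃)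

/-- `qtHalf N M = [N/2, M/2]_{q,t}`, where
`[n, m]_{q,t} = (q^{n/2} t^{m/2} - q^{-n/2} t^{-m/2}) / (q^{1/2} - q^{-1/2})`. -/
def qtHalf (N M : ℤ) : GroundField :=
  (q4 ^ N * t4 ^ M - q4 ^ (-N) * t4 ^ (-M)) / (q4 ^ 2 - (q4 ^ 2)⁻¹)

/-- The coefficient `C_{a,b}(j₁, j₂, j₃)` of the Pieri rule. All arguments of `qtHalf` are twice
the arguments of the corresponding bracket `[·,·]_{q,t}`. -/
def pieriCoeff (a b j₁ j₂ j₃ : ℤ) : GroundField :=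
  ((a * b : ℤ) : GroundField) *
    (qtHalf (a * j₁ + b * j₂ + j₃) (a + b + 2) * qtHalf (a * j₁ + b * j₂ - j₃) (a + b) *
      qtHalf (2 * (j₁ - 1)) (2 * 2) * qtHalf (2 * (j₂ - 1)) (2 * 2)) /
    (qtHalf (2 * j₁) (a + 3) * qtHalf (2 * (j₁ - 1)) (a + 3) *
      qtHalf (2 * j₂) (b + 3) * qtHalf (2 * (j₂ - 1)) (b + 3))

/-- The defining property of the family of genus two Macdonald polynomials: the three Pieri rules
at all admissible triples, vanishing at the other triples, and normalization at `(0, 0, 0)`. -/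
structure IsGenusTwoMacdonald (Ψ : ℤ → ℤ → ℤ → Laurent) : Prop where
  pieri₁₂ : ∀ j₁ j₂ j₃ : ℤ, Admissible j₁ j₂ j₃ →
    xsym 0 * Ψ j₁ j₂ j₃ = ∑ a ∈ ({-1, 1} : Finset ℤ), ∑ b ∈ ({-1, 1} : Finset ℤ),
      pieriCoeff a b j₁ j₂ j₃ • Ψ (j₁ + a) (j₂ + b) j₃
  pieri₁₃ : ∀ j₁ j₂ j₃ : ℤ, Admissible j₁ j₂ j₃ →
    xsym 1 * Ψ j₁ j₂ j₃ = ∑ a ∈ ({-1, 1} : Finset ℤ), ∑ b ∈ ({-1, 1} : Finset ℤ),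
      pieriCoeff a b j₁ j₃ j₂ • Ψ (j₁ + a) j₂ (j₃ + b)
  pieri₂₃ : ∀ j₁ j₂ j₃ : ℤ, Admissible j₁ j₂ j₃ →
    xsym 2 * Ψ j₁ j₂ j₃ = ∑ a ∈ ({-1, 1} : Finset ℤ), ∑ b ∈ ({-1, 1} : Finset ℤ),
      pieriCoeff a b j₂ j₃ j₁ • Ψ j₁ (j₂ + a) (j₃ + b)
  eq_zero : ∀ j₁ j₂ j₃ : ℤ, ¬ Admissible j₁ j₂ j₃ → Ψ j₁ j₂ j₃ = 0
  eq_one : Ψ 0 0 0 = 1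

/-- The eigenvalue `q^{j/2} t^{1/2} + q^{-j/2} t^{-1/2}`. -/
def eigenvalue (j : ℤ) : GroundField :=
  q4 ^ (2 * j) * t4 ^ 2 + q4 ^ (-(2 * j)) * (t4 ^ 2)⁻¹

end GenusTwo

end

noncomputable section

namespace GenusTwo

/-! Write X₁₂, X₁₃, X₂₃ for the symmetric variables x + x⁻¹. The Pieri rules define three operators
on the free space with a basis of all integer triples. These operators commute (`pieri_comm`), so
the vector of (0,0,0) generates a module over polynomials in three variables. The monomial with
exponents (a,b,c) has leading triple (a+b, a+c, b+c), so the module is free (`polyVec_injective`),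
and it contains every admissible basis vector (`tripleVec_mem_range`). The polynomials representing
these vectors, evaluated at the X's, are the Ψ. Uniqueness holds because the raise-raise coefficient
never vanishes, so each Pieri rule determines its leading term from lower ones.

For the eigenvalue equation, let D be the difference operator of A₁. It commutes with X₂₃ and
satisfies D X² - (q^{1/2}+q^{-1/2}) X D X + X² D + (q^{1/2}-q^{-1/2})² D = 0 for X = X₁₂, X₁₃
(`diffOp_quadratic`). The diagonal operator with the claimed eigenvalues satisfies the same relation
with the Pieri operator (`pieri_quadratic`). Induction on j₁+j₂+j₃ then reduces everything to the
values of D on 1, X₁₂, X₁₃ and X₁₂X₁₃. A₂ and A₃ follow by relabelling.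

The eigenvalues are distinct enough to separate the terms of a Pieri rule; if Ψ vanished at a raised
triple, it would vanish at the triple below (`PieriFamily.raise_ne_zero`). Finally, the Ψ span the
ring generated by the X's, which is all of ℋ. The A operators are diagonal on this spanning set and
multiplication by X preserves ℋ, so the whole algebra acts. -/

/-! ### Nonvanishing of the brackets. -/

theorem t4_ne_zero : t4 ≠ 0 := by
  simp [t4]

theorem q4_pow_mul_t4_pow_inj {a b c d : ℕ} (h : q4 ^ a * t4 ^ b = q4 ^ c * t4 ^ d) :
    a = c ∧ b = d := by
  have key : ∀ a b : ℕ, q4 ^ a * t4 ^ b = algebraMap (MvPolynomial (Fin 2) ℂ) GroundField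
      (MvPolynomial.monomial (Finsupp.single 0 a + Finsupp.single 1 b) 1) := by
    intro a b
    rw [MvPolynomial.monomial_single_add, ← MvPolynomial.X_pow_eq_monomial]
    simp [q4, t4]
  rw [key, key] at h
  have h2 := MvPolynomial.monomial_left_injective (one_ne_zero (α := ℂ))
    (IsFractionRing.injective _ _ h)
  have h0 := DFunLike.congr_fun h2 0
  have h1 := DFunLike.congr_fun h2 1
  simpa using And.intro h0 h1

theorem q4_zpow_mul_t4_zpow_eq_one {n m : ℤ} (h : q4 ^ n * t4 ^ m = 1) : n = 0 ∧ m = 0 := by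
  have hq := q4_ne_zero
  have ht := t4_ne_zero
  have h2 : q4 ^ n.toNat * t4 ^ m.toNat = q4 ^ (-n).toNat * t4 ^ (-m).toNat := by
    have e : ∀ (z : GroundField) (hz : z ≠ 0) (n : ℤ), z ^ n.toNat = z ^ n * z ^ (-n).toNat := by
      intro z hz n
      rw [← zpow_natCast, ← zpow_natCast, ← zpow_add₀ hz]
      congr 1
      omega
    rw [e _ hq n, e _ ht m]
    linear_combination (q4 ^ (-n).toNat * t4 ^ (-m).toNat) * h
  obtain ⟨h3, h4⟩ := q4_pow_mul_t4_pow_inj h2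
  omega

/-- Otherwise q4^{2N} t4^{2M} = 1, against the independence of the two variables. Since the
denominators of the Pieri coefficients have nonzero second argument, they never vanish, whatever the
integers j. -/
theorem qtHalf_numerator_ne_zero {N M : ℤ} (h : N ≠ 0 ∨ M ≠ 0) :
    q4 ^ N * t4 ^ M - q4 ^ (-N) * t4 ^ (-M) ≠ 0 := by
  intro h0
  have hq := zpow_ne_zero N q4_ne_zero
  have ht := zpow_ne_zero M t4_ne_zero
  have h1 : q4 ^ (N + N) * t4 ^ (M + M) = 1 := by
    rw [zpow_add₀ q4_ne_zero, zpow_add₀ t4_ne_zero]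
    rw [zpow_neg, zpow_neg] at h0
    field_simp at h0
    linear_combination h0
  have := q4_zpow_mul_t4_zpow_eq_one h1
  omega

theorem q4_sq_sub_inv_ne_zero : q4 ^ 2 - (q4 ^ 2)⁻¹ ≠ 0 := by
  have := qtHalf_numerator_ne_zero (N := 2) (M := 0) (by simp)
  simpa [zpow_neg] using this

theorem qtHalf_ne_zero {N M : ℤ} (h : N ≠ 0 ∨ M ≠ 0) : qtHalf N M ≠ 0 :=
  div_ne_zero (qtHalf_numerator_ne_zero h) q4_sq_sub_inv_ne_zero

theorem qtHalf_zero_zero : qtHalf 0 0 = 0 := by simp [qtHalf]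

/-! ### Factorization of the Pieri coefficients. -/

/-- The part of the Pieri coefficient that depends on a single raised index. -/
def raiseFactor (j : ℤ) : GroundField := (qtHalf (2 * j) 4)⁻¹

/-- The part of the Pieri coefficient that depends on a single lowered index. -/
def lowerFactor (j : ℤ) : GroundField :=
  -qtHalf (2 * (j - 1)) 4 / (qtHalf (2 * j) 2 * qtHalf (2 * (j - 1)) 2)

/-- For a raised index the bracket [j-1,2] cancels. The sign ab is distributed as one factor -1 per
lowered index, which `lowerFactor` absorbs. -/
theorem pieriCoeff_raise_raise (j₁ j₂ j₃ : ℤ) : pieriCoeff 1 1 j₁ j₂ j₃ =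
    raiseFactor j₁ * raiseFactor j₂ *
      (qtHalf (j₁ + j₂ + j₃) 4 * qtHalf (j₁ + j₂ - j₃) 2) := by
  have h1 : qtHalf (2 * (j₁ - 1)) 4 ≠ 0 := qtHalf_ne_zero (by simp)
  have h2 : qtHalf (2 * (j₂ - 1)) 4 ≠ 0 := qtHalf_ne_zero (by simp)
  have h3 : qtHalf (2 * j₁) 4 ≠ 0 := qtHalf_ne_zero (by simp)
  have h4 : qtHalf (2 * j₂) 4 ≠ 0 := qtHalf_ne_zero (by simp)
  simp only [pieriCoeff, raiseFactor]
  norm_num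
  field_simp

theorem pieriCoeff_raise_lower (j₁ j₂ j₃ : ℤ) : pieriCoeff 1 (-1) j₁ j₂ j₃ =
    raiseFactor j₁ * lowerFactor j₂ *
      (qtHalf (j₁ - j₂ + j₃) 2 * qtHalf (j₁ - j₂ - j₃) 0) := by
  have h1 : qtHalf (2 * (j₁ - 1)) 4 ≠ 0 := qtHalf_ne_zero (by simp)
  have h3 : qtHalf (2 * j₁) 4 ≠ 0 := qtHalf_ne_zero (by simp)
  have h4 : qtHalf (2 * j₂) 2 ≠ 0 := qtHalf_ne_zero (by simp)
  have h5 : qtHalf (2 * (j₂ - 1)) 2 ≠ 0 := qtHalf_ne_zero (by simp)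
  simp only [pieriCoeff, raiseFactor, lowerFactor]
  norm_num [← sub_eq_add_neg]
  field_simp

theorem pieriCoeff_lower_raise (j₁ j₂ j₃ : ℤ) : pieriCoeff (-1) 1 j₁ j₂ j₃ =
    lowerFactor j₁ * raiseFactor j₂ *
      (qtHalf (-j₁ + j₂ + j₃) 2 * qtHalf (-j₁ + j₂ - j₃) 0) := by
  have h1 : qtHalf (2 * (j₂ - 1)) 4 ≠ 0 := qtHalf_ne_zero (by simp)
  have h3 : qtHalf (2 * j₂) 4 ≠ 0 := qtHalf_ne_zero (by simp)
  have h4 : qtHalf (2 * j₁) 2 ≠ 0 := qtHalf_ne_zero (by simp)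
  have h5 : qtHalf (2 * (j₁ - 1)) 2 ≠ 0 := qtHalf_ne_zero (by simp)
  simp only [pieriCoeff, raiseFactor, lowerFactor]
  norm_num
  field_simp

theorem pieriCoeff_lower_lower (j₁ j₂ j₃ : ℤ) : pieriCoeff (-1) (-1) j₁ j₂ j₃ =
    lowerFactor j₁ * lowerFactor j₂ *
      (qtHalf (-j₁ - j₂ + j₃) 0 * qtHalf (-j₁ - j₂ - j₃) (-2)) := by
  have h2 : qtHalf (2 * j₂) 2 ≠ 0 := qtHalf_ne_zero (by simp)
  have h3 : qtHalf (2 * (j₂ - 1)) 2 ≠ 0 := qtHalf_ne_zero (by simp)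
  have h4 : qtHalf (2 * j₁) 2 ≠ 0 := qtHalf_ne_zero (by simp)
  have h5 : qtHalf (2 * (j₁ - 1)) 2 ≠ 0 := qtHalf_ne_zero (by simp)
  simp only [pieriCoeff, lowerFactor]
  norm_num [← sub_eq_add_neg]
  field_simp

theorem raiseFactor_ne_zero (j : ℤ) : raiseFactor j ≠ 0 :=
  inv_ne_zero (qtHalf_ne_zero (by simp))

theorem pieriCoeff_raise_raise_ne_zero (j₁ j₂ j₃ : ℤ) : pieriCoeff 1 1 j₁ j₂ j₃ ≠ 0 := by
  rw [pieriCoeff_raise_raise]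
  exact mul_ne_zero (mul_ne_zero (raiseFactor_ne_zero _) (raiseFactor_ne_zero _))
    (mul_ne_zero (qtHalf_ne_zero (by simp)) (qtHalf_ne_zero (by simp)))

theorem pieriCoeff_symm (a b j₁ j₂ j₃ : ℤ) :
    pieriCoeff a b j₁ j₂ j₃ = pieriCoeff b a j₂ j₁ j₃ := by
  simp only [pieriCoeff]
  rw [show b * j₂ + a * j₁ = a * j₁ + b * j₂ by ring, mul_comm b a, add_comm b a]
  ring

theorem Admissible.swap₁₂ {j₁ j₂ j₃ : ℤ} (h : Admissible j₁ j₂ j₃) : Admissible j₂ j₁ j₃ := by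
  unfold Admissible at *
  rw [abs_sub_comm, add_comm j₂ j₁]
  tauto

theorem Admissible.swap₂₃ {j₁ j₂ j₃ : ℤ} (h : Admissible j₁ j₂ j₃) : Admissible j₁ j₃ j₂ := by
  unfold Admissible at *
  rw [Int.even_iff] at *
  rw [abs_le] at *
  omega

/-- A Pieri coefficient vanishes if it leads out of the set of admissible triples. -/
theorem pieriCoeff_eq_zero {a b j₁ j₂ j₃ : ℤ} (ha : a ∈ ({-1, 1} : Finset ℤ))
    (hb : b ∈ ({-1, 1} : Finset ℤ)) (h : Admissible j₁ j₂ j₃)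
    (h' : ¬ Admissible (j₁ + a) (j₂ + b) j₃) : pieriCoeff a b j₁ j₂ j₃ = 0 := by
  unfold Admissible at *
  rw [Int.even_iff] at *
  rw [abs_le] at *
  simp only [Finset.mem_insert, Finset.mem_singleton] at ha hb
  rcases ha with rfl | rfl <;> rcases hb with rfl | rfl
  -- A step can leave the admissible cone only from a wall of the triangle inequalities, and there
  -- the numerator contains [0,0] = 0. Raising both indices never leaves the cone.
  · rw [pieriCoeff_lower_lower, show -j₁ - j₂ + j₃ = 0 by omega, qtHalf_zero_zero]
    ring
  · rw [pieriCoeff_lower_raise, show -j₁ + j₂ - j₃ = 0 by omega, qtHalf_zero_zero]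
    ring
  · rw [pieriCoeff_raise_lower, show j₁ - j₂ - j₃ = 0 by omega, qtHalf_zero_zero]
    ring
  · omega

/-- The part of the Pieri coefficient that depends on a single index and its shift. -/
def shiftFactor (a j : ℤ) : GroundField := if a = 1 then raiseFactor j else lowerFactor j

/-- The part of the Pieri coefficient that depends on all three indices. -/
def pieriNumerator (a b j₁ j₂ j₃ : ℤ) : GroundField :=
  qtHalf (a * j₁ + b * j₂ + j₃) (a + b + 2) * qtHalf (a * j₁ + b * j₂ - j₃) (a + b)

theorem pieriCoeff_eq {a b : ℤ} (ha : a = -1 ∨ a = 1) (hb : b = -1 ∨ b = 1) (j₁ j₂ j₃ : ℤ) :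
    pieriCoeff a b j₁ j₂ j₃ = shiftFactor a j₁ * shiftFactor b j₂ * pieriNumerator a b j₁ j₂ j₃ := by
  rcases ha with rfl | rfl <;> rcases hb with rfl | rfl
  · rw [pieriCoeff_lower_lower]; norm_num [shiftFactor, pieriNumerator, ← sub_eq_add_neg]
  · rw [pieriCoeff_lower_raise]; norm_num [shiftFactor, pieriNumerator]
  · rw [pieriCoeff_raise_lower]; norm_num [shiftFactor, pieriNumerator, ← sub_eq_add_neg]
  · rw [pieriCoeff_raise_raise]; norm_num [shiftFactor, pieriNumerator]

/-- A step and its reverse: the brackets with second argument 2 cancel, leaving an expression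
symmetric in the two endpoints. -/
theorem shiftFactor_mul {a : ℤ} (ha : a = -1 ∨ a = 1) (j : ℤ) :
    shiftFactor a j * shiftFactor (-a) (j + a) =
      -(qtHalf (2 * j) 2 * qtHalf (2 * (j + a)) 2)⁻¹ := by
  have h (n : ℤ) : qtHalf n 2 ≠ 0 := qtHalf_ne_zero (by simp)
  have h' (n : ℤ) : qtHalf n 4 ≠ 0 := qtHalf_ne_zero (by simp)
  rcases ha with rfl | rfl
  · have h1 := h (2 * j)
    have h2 := h (2 * (j - 1))
    have h3 := h' (2 * (j - 1))
    norm_num [shiftFactor, raiseFactor, lowerFactor, ← sub_eq_add_neg]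
    field_simp
  · have h1 := h (2 * j)
    have h2 := h (2 * (j + 1))
    have h3 := h' (2 * j)
    norm_num [shiftFactor, raiseFactor, lowerFactor]
    field_simp

/-- The eigenvalue is z + z⁻¹ with z = q^{j/2} t^{1/2}, and raising j multiplies z by q^{1/2}. -/
theorem eigenvalue_add_one_add_eigenvalue_sub_one (j : ℤ) :
    eigenvalue (j + 1) + eigenvalue (j - 1) = (q4 ^ 2 + (q4 ^ 2)⁻¹) * eigenvalue j := by
  have hq := q4_ne_zero
  have ht := t4_ne_zero
  have h1 := zpow_ne_zero j q4_ne_zero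
  simp only [eigenvalue, neg_add, neg_sub, mul_add, mul_sub, two_mul, zpow_add₀ hq,
    zpow_sub₀ hq, zpow_neg, zpow_one]
  generalize q4 ^ j = u at *
  field_simp
  ring

/-- By the three-term recurrence the left side is the eigenvalue at j minus that at j + 2a, a
difference that factors. -/
theorem two_mul_eigenvalue_sub {a : ℤ} (ha : a = -1 ∨ a = 1) (j : ℤ) :
    2 * eigenvalue j - (q4 ^ 2 + (q4 ^ 2)⁻¹) * eigenvalue (j + a) =
      -(a : GroundField) * (q4 ^ 2 - (q4 ^ 2)⁻¹) ^ 2 * qtHalf (2 * (j + a)) 2 := by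
  have hd := q4_sq_sub_inv_ne_zero
  have e : (q4 ^ 2 - (q4 ^ 2)⁻¹) ^ 2 * qtHalf (2 * (j + a)) 2 = (q4 ^ 2 - (q4 ^ 2)⁻¹) *
      (q4 ^ (2 * (j + a)) * t4 ^ (2 : ℤ) - q4 ^ (-(2 * (j + a))) * t4 ^ (-2 : ℤ)) := by
    rw [qtHalf]
    field_simp
  rw [mul_assoc, e]
  have hq := q4_ne_zero
  have ht := t4_ne_zero
  have h1 := zpow_ne_zero j q4_ne_zero
  rcases ha with rfl | rfl <;>
  · simp only [eigenvalue, neg_add, mul_add, two_mul, zpow_add₀ hq, zpow_neg,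
      zpow_ofNat, Int.cast_neg, Int.cast_one]
    generalize q4 ^ j = u at *
    field_simp
    ring

/-- The bracket at j + a cancels, so the weights of the two paths j → j ± 1 → j in the quadratic
relation differ only in sign. -/
theorem shiftFactor_mul_eigenvalue {a : ℤ} (ha : a = -1 ∨ a = 1) (j : ℤ) :
    shiftFactor a j * shiftFactor (-a) (j + a) *
      (2 * eigenvalue j - (q4 ^ 2 + (q4 ^ 2)⁻¹) * eigenvalue (j + a)) =
      a * (q4 ^ 2 - (q4 ^ 2)⁻¹) ^ 2 * (qtHalf (2 * j) 2)⁻¹ := by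
  have h (n : ℤ) : qtHalf n 2 ≠ 0 := qtHalf_ne_zero (by simp)
  have h1 := h (2 * j)
  have h2 := h (2 * (j + a))
  rw [shiftFactor_mul ha, two_mul_eigenvalue_sub ha]
  field_simp

/-! ### Commutation and quadratic relations of the Pieri coefficients. -/

/-- The part of the commutator of X₁₂ and X₁₃ that returns to j₁, cleared of the common denominator
of the shift factors. It is homogeneous in the brackets, so q^{1/2} - q^{-1/2} may be replaced by
any nonzero d. -/
theorem pieriNumerator_comm {b c : ℤ} (hb : b = -1 ∨ b = 1) (hc : c = -1 ∨ c = 1)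
    (j₁ j₂ j₃ : ℤ) :
    qtHalf (2 * (j₁ - 1)) 2 *
      (pieriNumerator 1 b j₁ j₂ j₃ * pieriNumerator (-1) c (j₁ + 1) j₃ (j₂ + b) -
        pieriNumerator 1 c j₁ j₃ j₂ * pieriNumerator (-1) b (j₁ + 1) j₂ (j₃ + c)) +
    qtHalf (2 * (j₁ + 1)) 2 *
      (pieriNumerator (-1) b j₁ j₂ j₃ * pieriNumerator 1 c (j₁ - 1) j₃ (j₂ + b) -
        pieriNumerator (-1) c j₁ j₃ j₂ * pieriNumerator 1 b (j₁ - 1) j₂ (j₃ + c)) = 0 := by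
  have hd := q4_sq_sub_inv_ne_zero
  have hq := q4_ne_zero
  have ht := t4_ne_zero
  have h1 := zpow_ne_zero j₁ q4_ne_zero
  have h2 := zpow_ne_zero j₂ q4_ne_zero
  have h3 := zpow_ne_zero j₃ q4_ne_zero
  rcases hb with rfl | rfl <;> rcases hc with rfl | rfl <;>
  · simp only [pieriNumerator, qtHalf, one_mul, neg_mul, neg_add, neg_sub, neg_neg, mul_add,
      mul_sub, two_mul, zpow_add₀ hq, zpow_add₀ ht, zpow_sub₀ hq, zpow_neg, zpow_ofNat]
    generalize q4 ^ 2 - (q4 ^ 2)⁻¹ = d at *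
    generalize q4 ^ j₁ = u at *
    generalize q4 ^ j₂ = v at *
    generalize q4 ^ j₃ = w at *
    generalize q4 = q at *
    generalize t4 = t at *
    field_simp
    ring

theorem pieriNumerator_comm_same {a b c : ℤ} (ha : a = -1 ∨ a = 1) (hb : b = -1 ∨ b = 1)
    (hc : c = -1 ∨ c = 1) (j₁ j₂ j₃ : ℤ) :
    pieriNumerator a b j₁ j₂ j₃ * pieriNumerator a c (j₁ + a) j₃ (j₂ + b) =
      pieriNumerator a c j₁ j₃ j₂ * pieriNumerator a b (j₁ + a) j₂ (j₃ + c) := by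
  have hd := q4_sq_sub_inv_ne_zero
  have hq := q4_ne_zero
  have ht := t4_ne_zero
  have h1 := zpow_ne_zero j₁ q4_ne_zero
  have h2 := zpow_ne_zero j₂ q4_ne_zero
  have h3 := zpow_ne_zero j₃ q4_ne_zero
  rcases ha with rfl | rfl <;> rcases hb with rfl | rfl <;> rcases hc with rfl | rfl <;>
  · simp only [pieriNumerator, qtHalf, one_mul, neg_mul, neg_add, neg_sub, neg_neg,
      zpow_add₀ hq, zpow_add₀ ht, zpow_sub₀ hq, zpow_neg, zpow_ofNat]
    generalize q4 ^ 2 - (q4 ^ 2)⁻¹ = d at *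
    generalize q4 ^ j₁ = u at *
    generalize q4 ^ j₂ = v at *
    generalize q4 ^ j₃ = w at *
    generalize q4 = q at *
    generalize t4 = t at *
    field_simp

theorem pieriNumerator_quadratic_same {b : ℤ} (hb : b = -1 ∨ b = 1) (j₁ j₂ j₃ : ℤ) :
    pieriNumerator 1 b j₁ j₂ j₃ * pieriNumerator (-1) b (j₁ + 1) (j₂ + b) j₃ =
      pieriNumerator (-1) b j₁ j₂ j₃ * pieriNumerator 1 b (j₁ - 1) (j₂ + b) j₃ := by
  have hd := q4_sq_sub_inv_ne_zero
  have hq := q4_ne_zero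
  have ht := t4_ne_zero
  have h1 := zpow_ne_zero j₁ q4_ne_zero
  have h2 := zpow_ne_zero j₂ q4_ne_zero
  have h3 := zpow_ne_zero j₃ q4_ne_zero
  rcases hb with rfl | rfl <;>
  · simp only [pieriNumerator, qtHalf, one_mul, neg_mul, neg_add, neg_sub, neg_neg, mul_add,
      mul_sub, zpow_add₀ hq, zpow_add₀ ht, zpow_sub₀ hq, zpow_neg, zpow_ofNat]
    generalize q4 ^ 2 - (q4 ^ 2)⁻¹ = d at *
    generalize q4 ^ j₁ = u at *
    generalize q4 ^ j₂ = v at *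
    generalize q4 ^ j₃ = w at *
    generalize q4 = q at *
    generalize t4 = t at *
    field_simp

theorem pieriNumerator_quadratic (j₁ j₂ j₃ : ℤ) :
    qtHalf (2 * (j₂ - 1)) 2 *
      (pieriNumerator 1 1 j₁ j₂ j₃ * pieriNumerator (-1) (-1) (j₁ + 1) (j₂ + 1) j₃ -
        pieriNumerator (-1) 1 j₁ j₂ j₃ * pieriNumerator 1 (-1) (j₁ - 1) (j₂ + 1) j₃) +
    qtHalf (2 * (j₂ + 1)) 2 *
      (pieriNumerator 1 (-1) j₁ j₂ j₃ * pieriNumerator (-1) 1 (j₁ + 1) (j₂ - 1) j₃ -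
        pieriNumerator (-1) (-1) j₁ j₂ j₃ * pieriNumerator 1 1 (j₁ - 1) (j₂ - 1) j₃) =
    eigenvalue j₁ * (qtHalf (2 * j₁) 2 * qtHalf (2 * j₂) 2 * qtHalf (2 * (j₂ - 1)) 2 *
      qtHalf (2 * (j₂ + 1)) 2) := by
  have hd := q4_sq_sub_inv_ne_zero
  have hq := q4_ne_zero
  have ht := t4_ne_zero
  have h1 := zpow_ne_zero j₁ q4_ne_zero
  have h2 := zpow_ne_zero j₂ q4_ne_zero
  have h3 := zpow_ne_zero j₃ q4_ne_zero
  simp only [pieriNumerator, qtHalf, eigenvalue, one_mul, neg_mul, neg_add, neg_sub, neg_neg,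
    mul_add, mul_sub, two_mul, zpow_add₀ hq, zpow_add₀ ht, zpow_sub₀ hq, zpow_neg,
    zpow_ofNat]
  generalize hde : q4 ^ 2 - (q4 ^ 2)⁻¹ = d at *
  generalize q4 ^ j₁ = u at *
  generalize q4 ^ j₂ = v at *
  generalize q4 ^ j₃ = w at *
  generalize q4 = q at *
  generalize t4 = t at *
  field_simp
  -- Each product on the left has five brackets and the right side only four, so one factor d
  -- survives and its value matters.
  rw [← hde]
  field_simp
  ring

theorem pieriCoeff_comm_same {a b c : ℤ} (ha : a = -1 ∨ a = 1) (hb : b = -1 ∨ b = 1)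
    (hc : c = -1 ∨ c = 1) (j₁ j₂ j₃ : ℤ) :
    pieriCoeff a b j₁ j₂ j₃ * pieriCoeff a c (j₁ + a) j₃ (j₂ + b) =
      pieriCoeff a c j₁ j₃ j₂ * pieriCoeff a b (j₁ + a) j₂ (j₃ + c) := by
  simp only [pieriCoeff_eq ha hb, pieriCoeff_eq ha hc]
  linear_combination (shiftFactor a j₁ * shiftFactor b j₂ * shiftFactor a (j₁ + a) *
    shiftFactor c j₃) * pieriNumerator_comm_same ha hb hc j₁ j₂ j₃

/-- The products of opposite shift factors, over a common denominator. -/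
theorem exists_shiftFactor_mul (j : ℤ) : ∃ K : GroundField,
    shiftFactor 1 j * shiftFactor (-1) (j + 1) = -qtHalf (2 * (j - 1)) 2 * K ∧
    shiftFactor (-1) j * shiftFactor 1 (j - 1) = -qtHalf (2 * (j + 1)) 2 * K ∧
    K * (qtHalf (2 * j) 2 * qtHalf (2 * (j - 1)) 2 * qtHalf (2 * (j + 1)) 2) = 1 := by
  have h (n : ℤ) : qtHalf n 2 ≠ 0 := qtHalf_ne_zero (by simp)
  have h1 := h (2 * j)
  have h2 := h (2 * (j - 1))
  have h3 := h (2 * (j + 1))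
  refine ⟨(qtHalf (2 * j) 2 * qtHalf (2 * (j - 1)) 2 * qtHalf (2 * (j + 1)) 2)⁻¹, ?_, ?_, ?_⟩
  · rw [shiftFactor_mul (.inr rfl)]
    field_simp
  · have e := shiftFactor_mul (a := -1) (.inl rfl) j
    rw [neg_neg, ← sub_eq_add_neg] at e
    rw [e]
    field_simp
  · field_simp

theorem pieriCoeff_comm {b c : ℤ} (hb : b = -1 ∨ b = 1) (hc : c = -1 ∨ c = 1) (j₁ j₂ j₃ : ℤ) :
    pieriCoeff 1 b j₁ j₂ j₃ * pieriCoeff (-1) c (j₁ + 1) j₃ (j₂ + b) +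
      pieriCoeff (-1) b j₁ j₂ j₃ * pieriCoeff 1 c (j₁ - 1) j₃ (j₂ + b) =
    pieriCoeff 1 c j₁ j₃ j₂ * pieriCoeff (-1) b (j₁ + 1) j₂ (j₃ + c) +
      pieriCoeff (-1) c j₁ j₃ j₂ * pieriCoeff 1 b (j₁ - 1) j₂ (j₃ + c) := by
  obtain ⟨K, h1, h2, -⟩ := exists_shiftFactor_mul j₁
  have h := pieriNumerator_comm hb hc j₁ j₂ j₃
  have e1 : (1 : ℤ) = -1 ∨ (1 : ℤ) = 1 := .inr rfl
  have e2 : (-1 : ℤ) = -1 ∨ (-1 : ℤ) = 1 := .inl rfl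
  simp only [pieriCoeff_eq e1 hb, pieriCoeff_eq e1 hc, pieriCoeff_eq e2 hb, pieriCoeff_eq e2 hc]
  linear_combination (shiftFactor b j₂ * shiftFactor c j₃) *
    ((pieriNumerator 1 b j₁ j₂ j₃ * pieriNumerator (-1) c (j₁ + 1) j₃ (j₂ + b) -
        pieriNumerator 1 c j₁ j₃ j₂ * pieriNumerator (-1) b (j₁ + 1) j₂ (j₃ + c)) * h1 +
      (pieriNumerator (-1) b j₁ j₂ j₃ * pieriNumerator 1 c (j₁ - 1) j₃ (j₂ + b) -
        pieriNumerator (-1) c j₁ j₃ j₂ * pieriNumerator 1 b (j₁ - 1) j₂ (j₃ + c)) * h2 - K * h)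

/-- The coefficients of two Pieri rules that share an index commute. -/
theorem pieri_comm {M : Type*} [AddCommGroup M] [Module GroundField M] (ψ : ℤ → ℤ → ℤ → M)
    (j₁ j₂ j₃ : ℤ) :
    ∑ a ∈ ({-1, 1} : Finset ℤ), ∑ b ∈ ({-1, 1} : Finset ℤ), pieriCoeff a b j₁ j₂ j₃ •
      ∑ c ∈ ({-1, 1} : Finset ℤ), ∑ d ∈ ({-1, 1} : Finset ℤ),
        pieriCoeff c d (j₁ + a) j₃ (j₂ + b) • ψ (j₁ + a + c) (j₂ + b) (j₃ + d) =
    ∑ a ∈ ({-1, 1} : Finset ℤ), ∑ b ∈ ({-1, 1} : Finset ℤ), pieriCoeff a b j₁ j₃ j₂ •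
      ∑ c ∈ ({-1, 1} : Finset ℤ), ∑ d ∈ ({-1, 1} : Finset ℤ),
        pieriCoeff c d (j₁ + a) j₂ (j₃ + b) • ψ (j₁ + a + c) (j₂ + d) (j₃ + b) := by
  -- Terms are grouped by the shifts b, d of the unshared indices. For fixed b, d the shared index
  -- ends at j₁ ± 2, along a single path in each order, or at j₁, along two paths.
  have key (b d : ℤ) (hb : b = -1 ∨ b = 1) (hd : d = -1 ∨ d = 1) :
      ∑ a ∈ ({-1, 1} : Finset ℤ), ∑ c ∈ ({-1, 1} : Finset ℤ), (pieriCoeff a b j₁ j₂ j₃ *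
        pieriCoeff c d (j₁ + a) j₃ (j₂ + b)) • ψ (j₁ + a + c) (j₂ + b) (j₃ + d) =
      ∑ a ∈ ({-1, 1} : Finset ℤ), ∑ c ∈ ({-1, 1} : Finset ℤ), (pieriCoeff a d j₁ j₃ j₂ *
        pieriCoeff c b (j₁ + a) j₂ (j₃ + d)) • ψ (j₁ + a + c) (j₂ + b) (j₃ + d) := by
    have h1 := pieriCoeff_comm_same (.inl rfl) hb hd j₁ j₂ j₃
    have h2 := pieriCoeff_comm_same (.inr rfl) hb hd j₁ j₂ j₃
    have h3 := pieriCoeff_comm hb hd j₁ j₂ j₃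
    simp only [Finset.sum_pair (show (-1 : ℤ) ≠ 1 by decide), ← sub_eq_add_neg,
      add_sub_cancel_right, sub_add_cancel] at h1 ⊢
    rw [h1, h2]
    have h4 := congrArg (· • ψ j₁ (j₂ + b) (j₃ + d)) h3
    simp only [add_smul] at h4
    linear_combination (norm := abel) h4
  have m1 := key (-1) (-1) (.inl rfl) (.inl rfl)
  have m2 := key (-1) 1 (.inl rfl) (.inr rfl)
  have m3 := key 1 (-1) (.inr rfl) (.inl rfl)
  have m4 := key 1 1 (.inr rfl) (.inr rfl)
  simp only [Finset.sum_pair (show (-1 : ℤ) ≠ 1 by decide)] at m1 m2 m3 m4 ⊢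
  simp only [smul_add, smul_smul]
  linear_combination (norm := abel) m1 + m2 + m3 + m4

/-- The two paths to (j₁, j₂ + 2b) have equal numerators and opposite weights. -/
theorem pieriCoeff_quadratic_same {b : ℤ} (hb : b = -1 ∨ b = 1) (j₁ j₂ j₃ : ℤ) :
    pieriCoeff 1 b j₁ j₂ j₃ * pieriCoeff (-1) b (j₁ + 1) (j₂ + b) j₃ *
        (2 * eigenvalue j₁ - (q4 ^ 2 + (q4 ^ 2)⁻¹) * eigenvalue (j₁ + 1)) +
      pieriCoeff (-1) b j₁ j₂ j₃ * pieriCoeff 1 b (j₁ - 1) (j₂ + b) j₃ *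
        (2 * eigenvalue j₁ - (q4 ^ 2 + (q4 ^ 2)⁻¹) * eigenvalue (j₁ - 1)) = 0 := by
  have h1 := shiftFactor_mul_eigenvalue (a := 1) (.inr rfl) j₁
  have h2 := shiftFactor_mul_eigenvalue (a := -1) (.inl rfl) j₁
  have h := pieriNumerator_quadratic_same hb j₁ j₂ j₃
  have e1 : (1 : ℤ) = -1 ∨ (1 : ℤ) = 1 := .inr rfl
  have e2 : (-1 : ℤ) = -1 ∨ (-1 : ℤ) = 1 := .inl rfl
  simp only [neg_neg, ← sub_eq_add_neg, Int.cast_neg, Int.cast_one] at h1 h2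
  simp only [pieriCoeff_eq e1 hb, pieriCoeff_eq e2 hb]
  linear_combination (shiftFactor b j₂ * shiftFactor b (j₂ + b)) *
    (pieriNumerator 1 b j₁ j₂ j₃ * pieriNumerator (-1) b (j₁ + 1) (j₂ + b) j₃ * h1 +
      pieriNumerator (-1) b j₁ j₂ j₃ * pieriNumerator 1 b (j₁ - 1) (j₂ + b) j₃ * h2 +
      (q4 ^ 2 - (q4 ^ 2)⁻¹) ^ 2 * (qtHalf (2 * j₁) 2)⁻¹ * h)

theorem pieriCoeff_quadratic (j₁ j₂ j₃ : ℤ) :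
    (pieriCoeff 1 1 j₁ j₂ j₃ * pieriCoeff (-1) (-1) (j₁ + 1) (j₂ + 1) j₃ +
      pieriCoeff 1 (-1) j₁ j₂ j₃ * pieriCoeff (-1) 1 (j₁ + 1) (j₂ - 1) j₃) *
        (2 * eigenvalue j₁ - (q4 ^ 2 + (q4 ^ 2)⁻¹) * eigenvalue (j₁ + 1)) +
    (pieriCoeff (-1) 1 j₁ j₂ j₃ * pieriCoeff 1 (-1) (j₁ - 1) (j₂ + 1) j₃ +
      pieriCoeff (-1) (-1) j₁ j₂ j₃ * pieriCoeff 1 1 (j₁ - 1) (j₂ - 1) j₃) *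
        (2 * eigenvalue j₁ - (q4 ^ 2 + (q4 ^ 2)⁻¹) * eigenvalue (j₁ - 1)) +
    (q4 ^ 2 - (q4 ^ 2)⁻¹) ^ 2 * eigenvalue j₁ = 0 := by
  have h1 := shiftFactor_mul_eigenvalue (a := 1) (.inr rfl) j₁
  have h2 := shiftFactor_mul_eigenvalue (a := -1) (.inl rfl) j₁
  obtain ⟨K, k1, k2, k3⟩ := exists_shiftFactor_mul j₂
  have h := pieriNumerator_quadratic j₁ j₂ j₃
  have e1 : (1 : ℤ) = -1 ∨ (1 : ℤ) = 1 := .inr rfl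
  have e2 : (-1 : ℤ) = -1 ∨ (-1 : ℤ) = 1 := .inl rfl
  have hj : (qtHalf (2 * j₁) 2)⁻¹ * qtHalf (2 * j₁) 2 = 1 :=
    inv_mul_cancel₀ (qtHalf_ne_zero (by simp))
  simp only [neg_neg, ← sub_eq_add_neg, Int.cast_neg, Int.cast_one] at h1 h2
  simp only [pieriCoeff_eq e1 e1, pieriCoeff_eq e1 e2, pieriCoeff_eq e2 e1, pieriCoeff_eq e2 e2]
  generalize hP : pieriNumerator 1 1 j₁ j₂ j₃ = P at *
  generalize hP' : pieriNumerator (-1) (-1) (j₁ + 1) (j₂ + 1) j₃ = P' at *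
  generalize hQ : pieriNumerator 1 (-1) j₁ j₂ j₃ = Q at *
  generalize hQ' : pieriNumerator (-1) 1 (j₁ + 1) (j₂ - 1) j₃ = Q' at *
  generalize hR : pieriNumerator (-1) 1 j₁ j₂ j₃ = R at *
  generalize hR' : pieriNumerator 1 (-1) (j₁ - 1) (j₂ + 1) j₃ = R' at *
  generalize hS : pieriNumerator (-1) (-1) j₁ j₂ j₃ = S at *
  generalize hS' : pieriNumerator 1 1 (j₁ - 1) (j₂ - 1) j₃ = S' at *
  generalize hD : (q4 ^ 2 - (q4 ^ 2)⁻¹) ^ 2 = D at *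
  generalize (qtHalf (2 * j₁) 2)⁻¹ = r at *
  linear_combination
    (shiftFactor 1 j₂ * shiftFactor (-1) (j₂ + 1) * (P * P') +
      shiftFactor (-1) j₂ * shiftFactor 1 (j₂ - 1) * (Q * Q')) * h1 +
    (shiftFactor 1 j₂ * shiftFactor (-1) (j₂ + 1) * (R * R') +
      shiftFactor (-1) j₂ * shiftFactor 1 (j₂ - 1) * (S * S')) * h2 +
    D * r * (P * P' - R * R') * k1 + D * r * (Q * Q' - S * S') * k2 - D * r * K * h -
    D * eigenvalue j₁ * (r * qtHalf (2 * j₁) 2 * k3 + hj)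

/-- The quadratic relation between a Pieri rule and the diagonal action of the eigenvalues. -/
theorem pieri_quadratic {M : Type*} [AddCommGroup M] [Module GroundField M]
    (ψ : ℤ → ℤ → ℤ → M) (j₁ j₂ j₃ : ℤ) :
    ∑ a ∈ ({-1, 1} : Finset ℤ), ∑ b ∈ ({-1, 1} : Finset ℤ), pieriCoeff a b j₁ j₂ j₃ •
      ∑ c ∈ ({-1, 1} : Finset ℤ), ∑ d ∈ ({-1, 1} : Finset ℤ),
        pieriCoeff c d (j₁ + a) (j₂ + b) j₃ •
          (eigenvalue (j₁ + a + c) - (q4 ^ 2 + (q4 ^ 2)⁻¹) * eigenvalue (j₁ + a) +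
            eigenvalue j₁) • ψ (j₁ + a + c) (j₂ + b + d) j₃ +
    ((q4 ^ 2 - (q4 ^ 2)⁻¹) ^ 2 * eigenvalue j₁) • ψ j₁ j₂ j₃ = 0 := by
  have h0 := pieriCoeff_quadratic j₁ j₂ j₃
  have h1 := pieriCoeff_quadratic_same (b := 1) (.inr rfl) j₁ j₂ j₃
  have h2 := pieriCoeff_quadratic_same (b := -1) (.inl rfl) j₁ j₂ j₃
  have e1 := eigenvalue_add_one_add_eigenvalue_sub_one (j₁ + 1)
  have e2 := eigenvalue_add_one_add_eigenvalue_sub_one (j₁ - 1)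
  -- The recurrence removes the terms that end at j₁ ± 2; only those returning to j₁ remain.
  have f1 : eigenvalue (j₁ + 1 + 1) - (q4 ^ 2 + (q4 ^ 2)⁻¹) * eigenvalue (j₁ + 1) +
      eigenvalue j₁ = 0 := by
    rw [← e1, add_sub_cancel_right]
    ring
  have f2 : eigenvalue (j₁ - 1 - 1) - (q4 ^ 2 + (q4 ^ 2)⁻¹) * eigenvalue (j₁ - 1) +
      eigenvalue j₁ = 0 := by
    rw [← e2, sub_add_cancel]
    ring
  have f3 (z : GroundField) : eigenvalue j₁ - z + eigenvalue j₁ = 2 * eigenvalue j₁ - z := by ring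
  simp only [Finset.sum_pair (show (-1 : ℤ) ≠ 1 by decide), ← sub_eq_add_neg,
    add_sub_cancel_right, sub_add_cancel, f1, f2, zero_smul, smul_zero, zero_add,
    add_zero] at h2 ⊢
  generalize q4 ^ 2 + (q4 ^ 2)⁻¹ = s at *
  have g0 := congrArg (· • ψ j₁ j₂ j₃) h0
  have g1 := congrArg (· • ψ j₁ (j₂ + 1 + 1) j₃) h1
  have g2 := congrArg (· • ψ j₁ (j₂ - 1 - 1) j₃) h2
  simp only [add_smul, add_mul, mul_assoc, zero_smul] at g0 g1 g2
  simp only [smul_add, smul_smul, f3]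
  linear_combination (norm := abel) g0 + g1 + g2

/-! ### The shifts on rational functions. -/

theorem x_ne_zero (i : Fin 3) : x i ≠ 0 := by
  rw [x, Ne, FaithfulSMul.algebraMap_eq_zero_iff]
  simp [xpow]

theorem xpow_mul_xpow_neg (i : Fin 3) (n : ℤ) : xpow i n * xpow i (-n) = 1 := by
  simp [xpow, AddMonoidAlgebra.single_mul_single, ← Pi.single_add, AddMonoidAlgebra.one_def]

theorem algebraMap_xpow_neg_one (i : Fin 3) : algebraMap Laurent RatFun (xpow i (-1)) = (x i)⁻¹ := by
  refine eq_inv_of_mul_eq_one_right ?_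
  rw [x, ← map_mul, xpow_mul_xpow_neg, map_one]

theorem toRatFun_xsym (i : Fin 3) : toRatFun (xsym i) = x i + (x i)⁻¹ := by
  rw [xsym, map_add, ← algebraMap_xpow_neg_one]
  rfl

theorem x_sub_inv_ne_zero (i : Fin 3) : x i - (x i)⁻¹ ≠ 0 := by
  intro h
  rw [← algebraMap_xpow_neg_one, x, sub_eq_zero] at h
  have h1 := IsFractionRing.injective Laurent RatFun h
  simp only [xpow] at h1
  have h2 := (AddMonoidAlgebra.single_left_inj (one_ne_zero)).1 h1
  have h3 := congrFun h2 i
  simp at h3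

/-- The scalar `q^{1/2}` in the field of rational functions. -/
def qHalf : RatFun := algebraMap GroundField RatFun (q4 ^ 2)

theorem qHalf_ne_zero : qHalf ≠ 0 := by
  rw [qHalf, Ne, FaithfulSMul.algebraMap_eq_zero_iff]
  exact pow_ne_zero 2 q4_ne_zero

theorem shift_x_self (i : Fin 3) : shift i (x i) = qHalf * x i := by
  rw [shift, x, IsFractionRing.algEquivOfAlgEquiv_algebraMap]
  have : dilate i (Units.mk0 (q4 ^ 2) (pow_ne_zero 2 q4_ne_zero)) (xpow i 1) =
      (q4 ^ 2) • xpow i 1 := by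
    change dilateHom _ _ _ = _
    rw [xpow, dilateHom_single]
    simp
  rw [this, Algebra.smul_def, map_mul, ← IsScalarTower.algebraMap_apply]
  rfl

theorem shift_x_of_ne {i j : Fin 3} (h : i ≠ j) : shift i (x j) = x j := by
  rw [shift, x, IsFractionRing.algEquivOfAlgEquiv_algebraMap]
  congr 1
  change dilateHom _ _ _ = _
  rw [xpow, dilateHom_single]
  simp [h]

theorem shift_inv_x_self (i : Fin 3) : (shift i)⁻¹ (x i) = qHalf⁻¹ * x i := by
  change (shift i).symm (x i) = _
  rw [AlgEquiv.symm_apply_eq, map_mul, shift_x_self, map_inv₀, qHalf, AlgEquiv.commutes, ← qHalf,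
    inv_mul_cancel_left₀ qHalf_ne_zero]

theorem shift_inv_x_of_ne {i j : Fin 3} (h : i ≠ j) : (shift i)⁻¹ (x j) = x j := by
  change (shift i).symm (x j) = _
  rw [AlgEquiv.symm_apply_eq, shift_x_of_ne h]

theorem shift_zpow_x_self (i : Fin 3) {a : ℤ} (ha : a = -1 ∨ a = 1) :
    (shift i ^ a) (x i) = qHalf ^ a * x i := by
  rcases ha with rfl | rfl
  · simp [shift_inv_x_self]
  · simp [shift_x_self]

theorem shift_zpow_x_of_ne {i j : Fin 3} (h : i ≠ j) {a : ℤ} (ha : a = -1 ∨ a = 1) :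
    (shift i ^ a) (x j) = x j := by
  rcases ha with rfl | rfl
  · simp [shift_inv_x_of_ne h]
  · simp [shift_x_of_ne h]

theorem shift_zpow_qHalf (i : Fin 3) (a : ℤ) : (shift i ^ a) qHalf = qHalf := by
  rw [qHalf, AlgEquiv.commutes]

theorem diffOp_apply (u v w : Fin 3) (f : RatFun) :
    diffOp u v w f = ∑ a ∈ ({-1, 1} : Finset ℤ), ∑ b ∈ ({-1, 1} : Finset ℤ),
      opCoeff u v w a b * (shift u ^ a) ((shift v ^ b) f) := by
  simp [diffOp]

/-! ### Relations between the difference operators and the symmetric variables. -/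

/-- The symmetric variable `x_i + x_i⁻¹` as a rational function. -/
def xs (i : Fin 3) : RatFun := x i + (x i)⁻¹

section

variable {u v w : Fin 3}

theorem diffOp_xs_spectator_mul (huw : u ≠ w) (hvw : v ≠ w) (f : RatFun) :
    diffOp u v w (xs w * f) = xs w * diffOp u v w f := by
  rw [diffOp_apply, diffOp_apply, Finset.mul_sum]
  refine Finset.sum_congr rfl fun a ha => ?_
  rw [Finset.mul_sum]
  refine Finset.sum_congr rfl fun b hb => ?_
  simp only [Finset.mem_insert, Finset.mem_singleton] at ha hb
  simp only [xs, map_mul, map_add, map_inv₀, shift_zpow_x_of_ne huw ha, shift_zpow_x_of_ne hvw hb]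
  ring

/-- The relation holds term by term. With s = q^{1/2}, a shift turns X = x + x⁻¹ into Y = s^a x +
(s^a x)⁻¹, and both values of Y are roots of Y² - (s+s⁻¹)XY + X² + (s-s⁻¹)² = 0. The coefficients of
the operator play no role. -/
theorem diffOp_quadratic (huv : u ≠ v) (f : RatFun) :
    diffOp u v w (xs u * (xs u * f)) -
      (q4 ^ 2 + (q4 ^ 2)⁻¹) • (xs u * diffOp u v w (xs u * f)) +
      (xs u * (xs u * diffOp u v w f) + (q4 ^ 2 - (q4 ^ 2)⁻¹) ^ 2 • diffOp u v w f) = 0 := by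
  have hs := qHalf_ne_zero
  have hx := x_ne_zero u
  have h1 : algebraMap GroundField RatFun (q4 ^ 2 + (q4 ^ 2)⁻¹) = qHalf + qHalf⁻¹ := by
    rw [RingHom.map_add, map_inv₀]
    rfl
  have h2 : algebraMap GroundField RatFun ((q4 ^ 2 - (q4 ^ 2)⁻¹) ^ 2) =
      (qHalf - qHalf⁻¹) ^ 2 := by
    rw [RingHom.map_pow, RingHom.map_sub, map_inv₀]
    rfl
  simp only [diffOp_apply, Algebra.smul_def, h1, h2, Finset.mul_sum]
  simp only [← Finset.sum_sub_distrib, ← Finset.sum_add_distrib]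
  refine Finset.sum_eq_zero fun a ha => Finset.sum_eq_zero fun b hb => ?_
  simp only [Finset.mem_insert, Finset.mem_singleton] at ha hb
  have key : (qHalf ^ a * x u + (qHalf ^ a * x u)⁻¹) ^ 2 -
      (qHalf + qHalf⁻¹) * xs u * (qHalf ^ a * x u + (qHalf ^ a * x u)⁻¹) + xs u ^ 2 +
        (qHalf - qHalf⁻¹) ^ 2 = 0 := by
    rcases ha with rfl | rfl <;>
    · simp only [xs, zpow_neg_one, zpow_one]
      field_simp
      ring
  have e : (shift u ^ a) ((shift v ^ b) (xs u)) = qHalf ^ a * x u + (qHalf ^ a * x u)⁻¹ := by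
    simp only [xs, map_add, map_inv₀, shift_zpow_x_of_ne huv.symm hb, shift_zpow_x_self u ha]
  simp only [map_mul, e]
  linear_combination (opCoeff u v w a b * (shift u ^ a) ((shift v ^ b) f)) * key

theorem opCoeff_symm (u v w : Fin 3) (a b : ℤ) : opCoeff u v w a b = opCoeff v u w b a := by
  simp only [opCoeff, mul_comm b a]
  congr 1 <;> ring

theorem shift_comm (u v : Fin 3) : Commute (shift u) (shift v) := by
  have h (c d : GroundFieldˣ) (f : Laurent) :
      dilate u c (dilate v d f) = dilate v d (dilate u c f) := by
    change (dilateHom u c).comp (dilateHom v d) f = (dilateHom v d).comp (dilateHom u c) f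
    congr 1
    refine AddMonoidAlgebra.algHom_ext (fun m => ?_) (Subsingleton.elim _ _)
    simp only [AlgHom.comp_apply, dilateHom_single, one_mul]
    rw [mul_comm]
  ext f
  obtain ⟨g, k, -, rfl⟩ := IsFractionRing.div_surjective (A := Laurent) f
  simp only [AlgEquiv.mul_apply, map_div₀, shift, IsFractionRing.algEquivOfAlgEquiv_algebraMap,
    h _ _ g, h _ _ k]

theorem diffOp_symm (u v w : Fin 3) : diffOp u v w = diffOp v u w := by
  rw [diffOp, diffOp, Finset.sum_comm]
  refine Finset.sum_congr rfl fun b _ => Finset.sum_congr rfl fun a _ => ?_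
  rw [opCoeff_symm, ((shift_comm u v).zpow_zpow a b).eq]

end

/-! ### Values of the difference operators on 1, X_u and X_u X_v. -/

section
variable {K : Type*} [Field K]

/-- The coefficient of the difference operators, up to sign, over an arbitrary field. -/
def tripleCoeff (X Y Z t P : K) : K :=
  (1 - t * Z * P) * (1 - t * Z⁻¹ * P) / (t * P * (X - X⁻¹) * (Y - Y⁻¹))

variable {X Y Z s t : K}

/-- In the signed sum over X^{±1}, Y^{±1} the poles at X² = 1 and Y² = 1 cancel; likewise in the
next two identities. -/
theorem tripleCoeff_one (hX : X ≠ 0) (hY : Y ≠ 0) (hZ : Z ≠ 0) (ht : t ≠ 0)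
    (hX' : X - X⁻¹ ≠ 0) (hY' : Y - Y⁻¹ ≠ 0) :
    tripleCoeff X Y Z t (X * Y) - tripleCoeff X Y Z t (X * Y⁻¹) - tripleCoeff X Y Z t (X⁻¹ * Y) +
      tripleCoeff X Y Z t (X⁻¹ * Y⁻¹) = t + t⁻¹ := by
  have hX2 : X ^ 2 - 1 ≠ 0 := fun h => hX' (by field_simp; rw [h, mul_zero])
  have hY2 : Y ^ 2 - 1 ≠ 0 := fun h => hY' (by field_simp; rw [h, mul_zero])
  simp only [tripleCoeff]
  field_simp
  ring

theorem tripleCoeff_fst (hX : X ≠ 0) (hY : Y ≠ 0) (hZ : Z ≠ 0) (ht : t ≠ 0) (hs : s ≠ 0)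
    (hX' : X - X⁻¹ ≠ 0) (hY' : Y - Y⁻¹ ≠ 0) :
    (tripleCoeff X Y Z t (X * Y) - tripleCoeff X Y Z t (X * Y⁻¹)) * (s * X + (s * X)⁻¹) -
      (tripleCoeff X Y Z t (X⁻¹ * Y) -
      tripleCoeff X Y Z t (X⁻¹ * Y⁻¹)) * (s⁻¹ * X + (s⁻¹ * X)⁻¹) =
      (s * t + (s * t)⁻¹) * (X + X⁻¹) := by
  have hX2 : X ^ 2 - 1 ≠ 0 := fun h => hX' (by field_simp; rw [h, mul_zero])
  have hY2 : Y ^ 2 - 1 ≠ 0 := fun h => hY' (by field_simp; rw [h, mul_zero])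
  simp only [tripleCoeff]
  field_simp
  ring

theorem tripleCoeff_mul (hX : X ≠ 0) (hY : Y ≠ 0) (hZ : Z ≠ 0) (ht : t ≠ 0) (hs : s ≠ 0)
    (hX' : X - X⁻¹ ≠ 0) (hY' : Y - Y⁻¹ ≠ 0) :
    tripleCoeff X Y Z t (X * Y) * ((s * X + (s * X)⁻¹) * (s * Y + (s * Y)⁻¹)) -
      tripleCoeff X Y Z t (X * Y⁻¹) * ((s * X + (s * X)⁻¹) * (s⁻¹ * Y + (s⁻¹ * Y)⁻¹)) -
      tripleCoeff X Y Z t (X⁻¹ * Y) * ((s⁻¹ * X + (s⁻¹ * X)⁻¹) * (s * Y + (s * Y)⁻¹)) +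
      tripleCoeff X Y Z t (X⁻¹ * Y⁻¹) * ((s⁻¹ * X + (s⁻¹ * X)⁻¹) * (s⁻¹ * Y + (s⁻¹ * Y)⁻¹)) =
      (s ^ 2 * t + (s ^ 2 * t)⁻¹) * ((X + X⁻¹) * (Y + Y⁻¹)) - (s - s⁻¹) * (s - s⁻¹) * (Z + Z⁻¹) := by
  have hX2 : X ^ 2 - 1 ≠ 0 := fun h => hX' (by field_simp; rw [h, mul_zero])
  have hY2 : Y ^ 2 - 1 ≠ 0 := fun h => hY' (by field_simp; rw [h, mul_zero])
  simp only [tripleCoeff]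
  field_simp
  ring
end

/-- The scalar `t^{1/2}` in the field of rational functions. -/
def tHalf : RatFun := algebraMap GroundField RatFun (t4 ^ 2)

theorem tHalf_ne_zero : tHalf ≠ 0 := by
  rw [tHalf, Ne, FaithfulSMul.algebraMap_eq_zero_iff]
  exact pow_ne_zero 2 t4_ne_zero

theorem opCoeff_eq_tripleCoeff (u v w : Fin 3) (a b : ℤ) :
    opCoeff u v w a b =
      ((a * b : ℤ) : RatFun) * tripleCoeff (x u) (x v) (x w) tHalf (x u ^ a * x v ^ b) := by
  simp only [opCoeff, tripleCoeff, mul_div_assoc, mul_assoc]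
  rfl

theorem algebraMap_eigenvalue (n : ℕ) : algebraMap GroundField RatFun (eigenvalue n) =
    qHalf ^ n * tHalf + (qHalf ^ n * tHalf)⁻¹ := by
  have h : eigenvalue n = (q4 ^ 2) ^ n * t4 ^ 2 + ((q4 ^ 2) ^ n * t4 ^ 2)⁻¹ := by
    rw [eigenvalue, zpow_neg, zpow_mul, mul_inv]
    norm_cast
  rw [h, RingHom.map_add, map_inv₀, RingHom.map_mul, RingHom.map_pow]
  rfl

section

variable {u v : Fin 3}

theorem shift_shift_xs_fst (huv : u ≠ v) {a b : ℤ} (ha : a = -1 ∨ a = 1) (hb : b = -1 ∨ b = 1) :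
    (shift u ^ a) ((shift v ^ b) (xs u)) = qHalf ^ a * x u + (qHalf ^ a * x u)⁻¹ := by
  simp only [xs, map_add, map_inv₀, shift_zpow_x_of_ne huv.symm hb, shift_zpow_x_self u ha]

theorem shift_shift_xs_snd (huv : u ≠ v) {a b : ℤ} (ha : a = -1 ∨ a = 1) (hb : b = -1 ∨ b = 1) :
    (shift u ^ a) ((shift v ^ b) (xs v)) = qHalf ^ b * x v + (qHalf ^ b * x v)⁻¹ := by
  simp only [xs, map_add, map_inv₀, map_mul, map_zpow₀, shift_zpow_qHalf,
    shift_zpow_x_self v hb, shift_zpow_x_of_ne huv ha]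

theorem diffOp_one (u v w : Fin 3) : diffOp u v w 1 = eigenvalue 0 • 1 := by
  have h := tripleCoeff_one (x_ne_zero u) (x_ne_zero v) (x_ne_zero w) tHalf_ne_zero
    (x_sub_inv_ne_zero u) (x_sub_inv_ne_zero v)
  have e := algebraMap_eigenvalue 0
  rw [Nat.cast_zero] at e
  rw [Algebra.smul_def, e, pow_zero, one_mul, mul_one, ← h, diffOp_apply]
  simp only [Finset.sum_pair (show (-1 : ℤ) ≠ 1 by decide), opCoeff_eq_tripleCoeff, map_one,
    zpow_neg_one, zpow_one]
  push_cast
  ring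

theorem diffOp_xs_fst (huv : u ≠ v) (w : Fin 3) :
    diffOp u v w (xs u) = eigenvalue 1 • xs u := by
  have h := tripleCoeff_fst (x_ne_zero u) (x_ne_zero v) (x_ne_zero w) tHalf_ne_zero
    qHalf_ne_zero (x_sub_inv_ne_zero u) (x_sub_inv_ne_zero v)
  have e := algebraMap_eigenvalue 1
  rw [Nat.cast_one] at e
  have e1 : (1 : ℤ) = -1 ∨ (1 : ℤ) = 1 := .inr rfl
  have e2 : (-1 : ℤ) = -1 ∨ (-1 : ℤ) = 1 := .inl rfl
  rw [Algebra.smul_def, e, pow_one, xs, ← h, ← xs, diffOp_apply]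
  simp only [Finset.sum_pair (show (-1 : ℤ) ≠ 1 by decide), opCoeff_eq_tripleCoeff,
    shift_shift_xs_fst huv e1 e1, shift_shift_xs_fst huv e1 e2, shift_shift_xs_fst huv e2 e1,
    shift_shift_xs_fst huv e2 e2]
  simp only [zpow_neg_one, zpow_one]
  push_cast
  ring

theorem diffOp_xs_mul_xs (huv : u ≠ v) (w : Fin 3) :
    diffOp u v w (xs u * xs v) =
      eigenvalue 2 • (xs u * xs v) - (q4 ^ 2 - (q4 ^ 2)⁻¹) ^ 2 • xs w := by
  have h := tripleCoeff_mul (x_ne_zero u) (x_ne_zero v) (x_ne_zero w) tHalf_ne_zero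
    qHalf_ne_zero (x_sub_inv_ne_zero u) (x_sub_inv_ne_zero v)
  have e := algebraMap_eigenvalue 2
  rw [Nat.cast_ofNat] at e
  have e1 : (1 : ℤ) = -1 ∨ (1 : ℤ) = 1 := .inr rfl
  have e2 : (-1 : ℤ) = -1 ∨ (-1 : ℤ) = 1 := .inl rfl
  have h2 : algebraMap GroundField RatFun ((q4 ^ 2 - (q4 ^ 2)⁻¹) ^ 2) =
      (qHalf - qHalf⁻¹) * (qHalf - qHalf⁻¹) := by
    rw [RingHom.map_pow, RingHom.map_sub, map_inv₀, sq]
    rfl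
  have hxs (i : Fin 3) : x i + (x i)⁻¹ = xs i := rfl
  simp only [hxs] at h
  rw [Algebra.smul_def, Algebra.smul_def, e, h2, ← h, diffOp_apply]
  simp only [Finset.sum_pair (show (-1 : ℤ) ≠ 1 by decide), opCoeff_eq_tripleCoeff, map_mul,
    shift_shift_xs_fst huv e1 e1, shift_shift_xs_fst huv e1 e2, shift_shift_xs_fst huv e2 e1,
    shift_shift_xs_fst huv e2 e2, shift_shift_xs_snd huv e1 e1, shift_shift_xs_snd huv e1 e2,
    shift_shift_xs_snd huv e2 e1, shift_shift_xs_snd huv e2 e2]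
  simp only [zpow_neg_one, zpow_one]
  push_cast
  ring

end

instance instAlgebraNatGroundField : Algebra ℕ GroundField := Semiring.toNatAlgebra

instance instAlgebraIntGroundField : Algebra ℤ GroundField := Ring.toIntAlgebra _

/-! ### Families satisfying the Pieri rules are eigenfunctions. -/

/-- The hypotheses on a family of vectors that make it a family of joint solutions of the Pieri
rules for multiplication by `X₁₂`, `X₁₃` and `X₂₃`. -/
structure PieriFamily (X₁₂ X₁₃ X₂₃ : RatFun) (ψ : ℤ → ℤ → ℤ → RatFun) : Prop where
  pieri₁₂ : ∀ j₁ j₂ j₃ : ℤ, Admissible j₁ j₂ j₃ →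
    X₁₂ * ψ j₁ j₂ j₃ = ∑ a ∈ ({-1, 1} : Finset ℤ), ∑ b ∈ ({-1, 1} : Finset ℤ),
      pieriCoeff a b j₁ j₂ j₃ • ψ (j₁ + a) (j₂ + b) j₃
  pieri₁₃ : ∀ j₁ j₂ j₃ : ℤ, Admissible j₁ j₂ j₃ →
    X₁₃ * ψ j₁ j₂ j₃ = ∑ a ∈ ({-1, 1} : Finset ℤ), ∑ b ∈ ({-1, 1} : Finset ℤ),
      pieriCoeff a b j₁ j₃ j₂ • ψ (j₁ + a) j₂ (j₃ + b)
  pieri₂₃ : ∀ j₁ j₂ j₃ : ℤ, Admissible j₁ j₂ j₃ →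
    X₂₃ * ψ j₁ j₂ j₃ = ∑ a ∈ ({-1, 1} : Finset ℤ), ∑ b ∈ ({-1, 1} : Finset ℤ),
      pieriCoeff a b j₂ j₃ j₁ • ψ j₁ (j₂ + a) (j₃ + b)
  eq_zero : ∀ j₁ j₂ j₃ : ℤ, ¬ Admissible j₁ j₂ j₃ → ψ j₁ j₂ j₃ = 0
  eq_one : ψ 0 0 0 = 1

namespace PieriFamily

variable {X₁₂ X₁₃ X₂₃ : RatFun} {ψ : ℤ → ℤ → ℤ → RatFun}

/-- Relabelling lets one argument serve all three operators and all three kinds of raising. -/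
theorem swap₂₃ (h : PieriFamily X₁₂ X₁₃ X₂₃ ψ) :
    PieriFamily X₁₃ X₁₂ X₂₃ (fun j₁ j₂ j₃ => ψ j₁ j₃ j₂) where
  pieri₁₂ j₁ j₂ j₃ hj := h.pieri₁₃ j₁ j₃ j₂ hj.swap₂₃
  pieri₁₃ j₁ j₂ j₃ hj := h.pieri₁₂ j₁ j₃ j₂ hj.swap₂₃
  pieri₂₃ j₁ j₂ j₃ hj := by
    rw [h.pieri₂₃ j₁ j₃ j₂ hj.swap₂₃, Finset.sum_comm]
    simp only [pieriCoeff_symm _ _ j₂ j₃]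
  eq_zero j₁ j₂ j₃ hj := h.eq_zero j₁ j₃ j₂ fun h' => hj h'.swap₂₃
  eq_one := h.eq_one

theorem swap₁₂ (h : PieriFamily X₁₂ X₁₃ X₂₃ ψ) :
    PieriFamily X₁₂ X₂₃ X₁₃ (fun j₁ j₂ j₃ => ψ j₂ j₁ j₃) where
  pieri₁₂ j₁ j₂ j₃ hj := by
    rw [h.pieri₁₂ j₂ j₁ j₃ hj.swap₁₂, Finset.sum_comm]
    simp only [pieriCoeff_symm _ _ j₁ j₂]
  pieri₁₃ j₁ j₂ j₃ hj := h.pieri₂₃ j₂ j₁ j₃ hj.swap₁₂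
  pieri₂₃ j₁ j₂ j₃ hj := h.pieri₁₃ j₂ j₁ j₃ hj.swap₁₂
  eq_zero j₁ j₂ j₃ hj := h.eq_zero j₂ j₁ j₃ fun h' => hj h'.swap₁₂
  eq_one := h.eq_one

/-- A Pieri rule, multiplied by the coefficient of an earlier Pieri step; the intermediate triple
need not be admissible. -/
theorem smul_pieri₁₂ (h : PieriFamily X₁₂ X₁₃ X₂₃ ψ) {j₁ j₂ j₃ a b : ℤ}
    (ha : a ∈ ({-1, 1} : Finset ℤ)) (hb : b ∈ ({-1, 1} : Finset ℤ)) (hj : Admissible j₁ j₂ j₃) :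
    pieriCoeff a b j₁ j₂ j₃ • (X₁₂ * ψ (j₁ + a) (j₂ + b) j₃) =
      pieriCoeff a b j₁ j₂ j₃ • ∑ c ∈ ({-1, 1} : Finset ℤ), ∑ d ∈ ({-1, 1} : Finset ℤ),
        pieriCoeff c d (j₁ + a) (j₂ + b) j₃ • ψ (j₁ + a + c) (j₂ + b + d) j₃ := by
  by_cases h' : Admissible (j₁ + a) (j₂ + b) j₃
  · rw [h.pieri₁₂ _ _ _ h']
  · rw [pieriCoeff_eq_zero ha hb hj h', zero_smul, zero_smul]

theorem mul_mul_eq (h : PieriFamily X₁₂ X₁₃ X₂₃ ψ) {j₁ j₂ j₃ : ℤ} (hj : Admissible j₁ j₂ j₃) :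
    X₁₂ * (X₁₂ * ψ j₁ j₂ j₃) =
      ∑ a ∈ ({-1, 1} : Finset ℤ), ∑ b ∈ ({-1, 1} : Finset ℤ), pieriCoeff a b j₁ j₂ j₃ •
        ∑ c ∈ ({-1, 1} : Finset ℤ), ∑ d ∈ ({-1, 1} : Finset ℤ),
          pieriCoeff c d (j₁ + a) (j₂ + b) j₃ • ψ (j₁ + a + c) (j₂ + b + d) j₃ := by
  rw [h.pieri₁₂ _ _ _ hj, Finset.mul_sum]
  refine Finset.sum_congr rfl fun a ha => ?_
  rw [Finset.mul_sum]
  refine Finset.sum_congr rfl fun b hb => ?_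
  rw [mul_smul_comm, h.smul_pieri₁₂ ha hb hj]

variable {u v w : Fin 3}

/-- Subtracting the quadratic relation for the eigenvalues from that for the operator leaves a
combination of the defects Dψ - λψ. All but the top defect vanish by the hypothesis `ih`, and the
top one has nonzero coefficient. -/
theorem diffOp_raise_raise (huv : u ≠ v) (h : PieriFamily (xs u) X₁₃ X₂₃ ψ) {j₁ j₂ j₃ : ℤ}
    (hj : Admissible j₁ j₂ j₃)
    (ih : ∀ k₁ k₂ k₃ : ℤ, k₁ + k₂ + k₃ < j₁ + j₂ + j₃ + 4 →
      diffOp u v w (ψ k₁ k₂ k₃) = eigenvalue k₁ • ψ k₁ k₂ k₃) :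
    diffOp u v w (ψ (j₁ + 1 + 1) (j₂ + 1 + 1) j₃) =
      eigenvalue (j₁ + 1 + 1) • ψ (j₁ + 1 + 1) (j₂ + 1 + 1) j₃ := by
  have h1 := diffOp_quadratic (w := w) huv (ψ j₁ j₂ j₃)
  have h2 : xs u * diffOp u v w (xs u * ψ j₁ j₂ j₃) =
      ∑ a ∈ ({-1, 1} : Finset ℤ), ∑ b ∈ ({-1, 1} : Finset ℤ), pieriCoeff a b j₁ j₂ j₃ •
        ∑ c ∈ ({-1, 1} : Finset ℤ), ∑ d ∈ ({-1, 1} : Finset ℤ),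
          pieriCoeff c d (j₁ + a) (j₂ + b) j₃ •
            eigenvalue (j₁ + a) • ψ (j₁ + a + c) (j₂ + b + d) j₃ := by
    rw [h.pieri₁₂ _ _ _ hj, map_sum, Finset.mul_sum]
    refine Finset.sum_congr rfl fun a ha => ?_
    rw [map_sum, Finset.mul_sum]
    refine Finset.sum_congr rfl fun b hb => ?_
    have hlt : j₁ + a + (j₂ + b) + j₃ < j₁ + j₂ + j₃ + 4 := by
      simp only [Finset.mem_insert, Finset.mem_singleton] at ha hb
      omega
    rw [map_smul, ih _ _ _ hlt, smul_comm, mul_smul_comm, mul_smul_comm,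
      h.smul_pieri₁₂ ha hb hj]
    simp only [Finset.smul_sum]
    refine Finset.sum_congr rfl fun c _ => Finset.sum_congr rfl fun d _ => ?_
    module
  rw [h2, ih j₁ j₂ j₃ (by omega), mul_smul_comm, mul_smul_comm, h.mul_mul_eq hj] at h1
  simp only [map_sum, map_smul] at h1
  have h3 := pieri_quadratic ψ j₁ j₂ j₃
  have h4 : ∑ a ∈ ({-1, 1} : Finset ℤ), ∑ b ∈ ({-1, 1} : Finset ℤ), pieriCoeff a b j₁ j₂ j₃ •
      ∑ c ∈ ({-1, 1} : Finset ℤ), ∑ d ∈ ({-1, 1} : Finset ℤ),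
        pieriCoeff c d (j₁ + a) (j₂ + b) j₃ •
          (diffOp u v w (ψ (j₁ + a + c) (j₂ + b + d) j₃) -
            eigenvalue (j₁ + a + c) • ψ (j₁ + a + c) (j₂ + b + d) j₃) = 0 := by
    rw [← sub_zero (0 : RatFun)]
    nth_rewrite 1 [← h1]
    rw [← h3, smul_smul, ← add_assoc, add_sub_add_right_eq_sub]
    simp only [Finset.smul_sum, ← Finset.sum_sub_distrib, ← Finset.sum_add_distrib]
    refine Finset.sum_congr rfl fun a _ => Finset.sum_congr rfl fun b _ =>
      Finset.sum_congr rfl fun c _ => Finset.sum_congr rfl fun d _ => ?_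
    module
  have h5 (k₁ k₂ k₃ : ℤ) (hk : k₁ + k₂ + k₃ < j₁ + j₂ + j₃ + 4) :
      diffOp u v w (ψ k₁ k₂ k₃) - eigenvalue k₁ • ψ k₁ k₂ k₃ = 0 :=
    sub_eq_zero.2 (ih _ _ _ hk)
  simp (disch := omega) only [Finset.sum_pair (show (-1 : ℤ) ≠ 1 by decide), h5, smul_zero,
    zero_add, smul_eq_zero, pieriCoeff_raise_raise_ne_zero, false_or] at h4
  exact sub_eq_zero.1 h4

end PieriFamily

theorem eigenvalue_two_sub_eigenvalue_zero :
    eigenvalue 2 - eigenvalue 0 = (q4 ^ 2 - (q4 ^ 2)⁻¹) ^ 2 * qtHalf 2 2 := by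
  have hd := q4_sq_sub_inv_ne_zero
  have hq := q4_ne_zero
  have ht := t4_ne_zero
  have e : (q4 ^ 2 - (q4 ^ 2)⁻¹) ^ 2 * qtHalf 2 2 = (q4 ^ 2 - (q4 ^ 2)⁻¹) *
      (q4 ^ (2 : ℤ) * t4 ^ (2 : ℤ) - q4 ^ (-2 : ℤ) * t4 ^ (-2 : ℤ)) := by
    rw [qtHalf]
    field_simp
  rw [e]
  simp only [eigenvalue, zpow_neg, mul_zero, neg_zero, Int.reduceMul, zpow_ofNat]
  field_simp
  ring

theorem pieriCoeff_lower_raise_one_zero_one : pieriCoeff (-1) 1 1 0 1 = (qtHalf 2 2)⁻¹ := by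
  have h0 : qtHalf 0 4 ≠ 0 := qtHalf_ne_zero (by simp)
  have h1 : qtHalf 0 2 ≠ 0 := qtHalf_ne_zero (by simp)
  have h2 : qtHalf 2 2 ≠ 0 := qtHalf_ne_zero (by simp)
  have h3 : qtHalf (-2) 0 = -1 := by
    have hd := q4_sq_sub_inv_ne_zero
    simp only [qtHalf, zpow_neg, neg_neg, zpow_ofNat, neg_zero]
    rw [div_eq_iff hd]
    ring
  rw [pieriCoeff_lower_raise, lowerFactor, raiseFactor]
  norm_num [h3]
  field_simp

theorem admissible_zero : Admissible 0 0 0 := by simp [Admissible]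

theorem not_admissible_of_neg {j₁ j₂ j₃ : ℤ} (h : j₁ < 0 ∨ j₂ < 0 ∨ j₃ < 0) :
    ¬ Admissible j₁ j₂ j₃ := by
  unfold Admissible
  omega

namespace PieriFamily

variable {X₁₂ X₁₃ X₂₃ : RatFun} {ψ : ℤ → ℤ → ℤ → RatFun}

theorem eq_smul₁₂ (h : PieriFamily X₁₂ X₁₃ X₂₃ ψ) : X₁₂ = pieriCoeff 1 1 0 0 0 • ψ 1 1 0 := by
  have h1 := h.pieri₁₂ 0 0 0 admissible_zero
  have z1 : ψ (-1) (-1) 0 = 0 := h.eq_zero _ _ _ (not_admissible_of_neg (by decide))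
  have z2 : ψ (-1) 1 0 = 0 := h.eq_zero _ _ _ (not_admissible_of_neg (by decide))
  have z3 : ψ 1 (-1) 0 = 0 := h.eq_zero _ _ _ (not_admissible_of_neg (by decide))
  simpa [h.eq_one, z1, z2, z3, Finset.sum_pair (show (-1 : ℤ) ≠ 1 by decide)] using h1

/-- The X₁₂ rule at (1,0,1), where two terms vanish for a negative index. X₁₃ and X₂₃ are the same
multiple of ψ at (1,0,1) and (0,1,1). -/
theorem mul_eq_smul₂₁₁ (h : PieriFamily X₁₂ X₁₃ X₂₃ ψ) :
    X₁₂ * X₁₃ = (pieriCoeff 1 1 0 0 0 * pieriCoeff 1 1 1 0 1) • ψ 2 1 1 +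
      (qtHalf 2 2)⁻¹ • X₂₃ := by
  have h1 := h.pieri₁₂ 1 0 1 (by simp [Admissible])
  have z1 : ψ 0 (-1) 1 = 0 := h.eq_zero _ _ _ (not_admissible_of_neg (by decide))
  have z2 : ψ 2 (-1) 1 = 0 := h.eq_zero _ _ _ (not_admissible_of_neg (by decide))
  simp only [Finset.sum_pair (show (-1 : ℤ) ≠ 1 by decide), Int.reduceNeg, Int.reduceAdd, z1, z2,
    smul_zero, zero_add, pieriCoeff_lower_raise_one_zero_one] at h1
  have h2 : X₁₃ = pieriCoeff 1 1 0 0 0 • ψ 1 0 1 := h.swap₂₃.eq_smul₁₂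
  have h3 : X₂₃ = pieriCoeff 1 1 0 0 0 • ψ 0 1 1 := h.swap₁₂.swap₂₃.eq_smul₁₂
  rw [h2, h3, mul_smul_comm, h1]
  module

variable {u v w : Fin 3}

/-- Multiplication by X₂₃ fixes j₁ and commutes with the operator, so the leading term inherits the
eigenvalue of the others. -/
theorem diffOp_raise_spectator (huw : u ≠ w) (hvw : v ≠ w)
    (h : PieriFamily X₁₂ X₁₃ (xs w) ψ) {j₁ j₂ j₃ : ℤ} (hj : Admissible j₁ j₂ j₃)
    (ih : ∀ k₁ k₂ k₃ : ℤ, k₁ + k₂ + k₃ < j₁ + j₂ + j₃ + 2 →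
      diffOp u v w (ψ k₁ k₂ k₃) = eigenvalue k₁ • ψ k₁ k₂ k₃) :
    diffOp u v w (ψ j₁ (j₂ + 1) (j₃ + 1)) = eigenvalue j₁ • ψ j₁ (j₂ + 1) (j₃ + 1) := by
  have h1 := diffOp_xs_spectator_mul (u := u) (v := v) huw hvw (ψ j₁ j₂ j₃)
  rw [ih _ _ _ (by omega), mul_smul_comm, h.pieri₂₃ _ _ _ hj] at h1
  simp (disch := omega) only [Finset.sum_pair (show (-1 : ℤ) ≠ 1 by decide), map_add, map_smul,
    ih] at h1
  have h2 : pieriCoeff 1 1 j₂ j₃ j₁ • (diffOp u v w (ψ j₁ (j₂ + 1) (j₃ + 1)) -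
      eigenvalue j₁ • ψ j₁ (j₂ + 1) (j₃ + 1)) = 0 := by
    linear_combination (norm := module) h1
  simpa [pieriCoeff_raise_raise_ne_zero, sub_eq_zero] using h2

/-- The difference operator acts diagonally on a family that satisfies the Pieri rules. -/
theorem diffOp_eq_smul (huv : u ≠ v) (huw : u ≠ w) (hvw : v ≠ w)
    (h : PieriFamily (xs u) (xs v) (xs w) ψ) (j₁ j₂ j₃ : ℤ) :
    diffOp u v w (ψ j₁ j₂ j₃) = eigenvalue j₁ • ψ j₁ j₂ j₃ := by
  induction hn : (j₁ + j₂ + j₃).toNat using Nat.strong_induction_on generalizing j₁ j₂ j₃ with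
  | _ n ih =>
  by_cases hj : Admissible j₁ j₂ j₃
  swap
  · rw [h.eq_zero _ _ _ hj, map_zero, smul_zero]
  have ih' (k₁ k₂ k₃ : ℤ) (hk : k₁ + k₂ + k₃ < j₁ + j₂ + j₃) :
      diffOp u v w (ψ k₁ k₂ k₃) = eigenvalue k₁ • ψ k₁ k₂ k₃ := by
    by_cases hk' : Admissible k₁ k₂ k₃
    · have := hk'.1
      have := hk'.2.1
      have := hk'.2.2.1
      exact ih _ (by omega) _ _ _ rfl
    · rw [h.eq_zero _ _ _ hk', map_zero, smul_zero]
  have hj' := hj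
  unfold Admissible at hj'
  rw [Int.even_iff, abs_le] at hj'
  -- Off the wall j₁ = j₂ + j₃, parity gives j₁ ≤ j₂ + j₃ - 2, so lowering j₂ and j₃ stays
  -- admissible. On the wall the quadratic relation raises j₁ and another index by 2, which leaves
  -- four seeds with j₂, j₃ ≤ 1.
  by_cases h1 : j₁ < j₂ + j₃
  · have := h.diffOp_raise_spectator (u := u) (v := v) huw hvw
      (j₁ := j₁) (j₂ := j₂ - 1) (j₃ := j₃ - 1)
      (by unfold Admissible; rw [Int.even_iff, abs_le]; omega)
      (fun k₁ k₂ k₃ hk => ih' _ _ _ (by omega))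
    simpa using this
  obtain rfl : j₁ = j₂ + j₃ := by omega
  by_cases h2 : 2 ≤ j₂
  · have := h.diffOp_raise_raise (w := w) huv (j₁ := j₂ + j₃ - 2) (j₂ := j₂ - 2) (j₃ := j₃)
      (by unfold Admissible; rw [Int.even_iff, abs_le]; omega)
      (fun k₁ k₂ k₃ hk => ih' _ _ _ (by omega))
    rwa [show j₂ + j₃ - 2 + 1 + 1 = j₂ + j₃ by ring, show j₂ - 2 + 1 + 1 = j₂ by ring] at this
  by_cases h3 : 2 ≤ j₃
  · have := h.swap₂₃.diffOp_raise_raise (w := w) huv.symm (j₁ := j₂ + j₃ - 2) (j₂ := j₃ - 2)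
      (j₃ := j₂) (by unfold Admissible; rw [Int.even_iff, abs_le]; omega)
      (fun k₁ k₂ k₃ hk => by rw [diffOp_symm]; exact ih' _ _ _ (by omega))
    rwa [show j₂ + j₃ - 2 + 1 + 1 = j₂ + j₃ by ring, show j₃ - 2 + 1 + 1 = j₃ by ring,
      diffOp_symm] at this
  have hw : diffOp u v w (xs w) = eigenvalue 0 • xs w := by
    have := diffOp_xs_spectator_mul (u := u) (v := v) huw hvw 1
    rwa [diffOp_one, mul_smul_comm, mul_one] at this
  have cancel {c e : GroundField} {f g : RatFun} (hc : c ≠ 0) (hg : g = c • f)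
      (he : diffOp u v w g = e • g) : diffOp u v w f = e • f := by
    rw [hg, map_smul, smul_comm] at he
    exact smul_right_injective _ hc he
  have c0 := pieriCoeff_raise_raise_ne_zero 0 0 0
  have cases₂ : j₂ = 0 ∨ j₂ = 1 := by omega
  have cases₃ : j₃ = 0 ∨ j₃ = 1 := by omega
  rcases cases₂ with rfl | rfl <;> rcases cases₃ with rfl | rfl
  · rw [zero_add, h.eq_one, diffOp_one]
  · have := diffOp_xs_fst huv.symm w
    rw [diffOp_symm] at this
    exact cancel c0 h.swap₂₃.eq_smul₁₂ this
  · exact cancel c0 h.eq_smul₁₂ (diffOp_xs_fst huv w)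
  · have e := h.mul_eq_smul₂₁₁
    refine cancel (mul_ne_zero c0 (pieriCoeff_raise_raise_ne_zero 1 0 1))
      (sub_eq_of_eq_add e) ?_
    have hm := diffOp_xs_mul_xs huv w
    -- The X_w correction in ψ at (2,1,1) must absorb the X_w term of the operator's value on X_u
    -- X_v; this equality makes them match.
    have hγ : (qtHalf 2 2)⁻¹ * (eigenvalue 2 - eigenvalue 0) = (q4 ^ 2 - (q4 ^ 2)⁻¹) ^ 2 := by
      rw [eigenvalue_two_sub_eigenvalue_zero, mul_comm,
        mul_inv_cancel_right₀ (qtHalf_ne_zero (by simp))]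
    rw [map_sub, map_smul, hm, hw, ← hγ]
    change _ = eigenvalue 2 • _
    module

end PieriFamily

/-! ### The commuting formal Pieri operators. -/

/-- The space with basis indexed by all integer triples, on which the Pieri rules act formally. -/
abbrev TripleSpace : Type := (ℤ × ℤ × ℤ) →₀ GroundField

/-- The basis vector of a triple. -/
def tripleVec (j₁ j₂ j₃ : ℤ) : TripleSpace := Finsupp.single (j₁, j₂, j₃) 1

/-- The formal Pieri operator that shifts the first two indices. -/
def pieriOp₁₂ : TripleSpace →ₗ[GroundField] TripleSpace :=
  Finsupp.linearCombination GroundField fun j =>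
    ∑ a ∈ ({-1, 1} : Finset ℤ), ∑ b ∈ ({-1, 1} : Finset ℤ),
      pieriCoeff a b j.1 j.2.1 j.2.2 • tripleVec (j.1 + a) (j.2.1 + b) j.2.2

/-- The formal Pieri operator that shifts the first and the third index. -/
def pieriOp₁₃ : TripleSpace →ₗ[GroundField] TripleSpace :=
  Finsupp.linearCombination GroundField fun j =>
    ∑ a ∈ ({-1, 1} : Finset ℤ), ∑ b ∈ ({-1, 1} : Finset ℤ),
      pieriCoeff a b j.1 j.2.2 j.2.1 • tripleVec (j.1 + a) j.2.1 (j.2.2 + b)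

/-- The formal Pieri operator that shifts the last two indices. -/
def pieriOp₂₃ : TripleSpace →ₗ[GroundField] TripleSpace :=
  Finsupp.linearCombination GroundField fun j =>
    ∑ a ∈ ({-1, 1} : Finset ℤ), ∑ b ∈ ({-1, 1} : Finset ℤ),
      pieriCoeff a b j.2.1 j.2.2 j.1 • tripleVec j.1 (j.2.1 + a) (j.2.2 + b)

theorem pieriOp₁₂_tripleVec (j₁ j₂ j₃ : ℤ) : pieriOp₁₂ (tripleVec j₁ j₂ j₃) =
    ∑ a ∈ ({-1, 1} : Finset ℤ), ∑ b ∈ ({-1, 1} : Finset ℤ),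
      pieriCoeff a b j₁ j₂ j₃ • tripleVec (j₁ + a) (j₂ + b) j₃ := by
  rw [pieriOp₁₂, tripleVec, Finsupp.linearCombination_single, one_smul]

theorem pieriOp₁₃_tripleVec (j₁ j₂ j₃ : ℤ) : pieriOp₁₃ (tripleVec j₁ j₂ j₃) =
    ∑ a ∈ ({-1, 1} : Finset ℤ), ∑ b ∈ ({-1, 1} : Finset ℤ),
      pieriCoeff a b j₁ j₃ j₂ • tripleVec (j₁ + a) j₂ (j₃ + b) := by
  rw [pieriOp₁₃, tripleVec, Finsupp.linearCombination_single, one_smul]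

theorem pieriOp₂₃_tripleVec (j₁ j₂ j₃ : ℤ) : pieriOp₂₃ (tripleVec j₁ j₂ j₃) =
    ∑ a ∈ ({-1, 1} : Finset ℤ), ∑ b ∈ ({-1, 1} : Finset ℤ),
      pieriCoeff a b j₂ j₃ j₁ • tripleVec j₁ (j₂ + a) (j₃ + b) := by
  rw [pieriOp₂₃, tripleVec, Finsupp.linearCombination_single, one_smul]

theorem tripleSpace_lhom_ext {M : Type*} [AddCommMonoid M] [Module GroundField M]
    {f g : TripleSpace →ₗ[GroundField] M}
    (h : ∀ j₁ j₂ j₃ : ℤ, f (tripleVec j₁ j₂ j₃) = g (tripleVec j₁ j₂ j₃)) : f = g :=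
  Finsupp.lhom_ext' fun j => LinearMap.ext_ring (h j.1 j.2.1 j.2.2)

theorem pieriOp₁₂_comm_pieriOp₁₃ (f : TripleSpace) :
    pieriOp₁₂ (pieriOp₁₃ f) = pieriOp₁₃ (pieriOp₁₂ f) := by
  refine LinearMap.congr_fun (f := pieriOp₁₂ ∘ₗ pieriOp₁₃) (g := pieriOp₁₃ ∘ₗ pieriOp₁₂)
    (tripleSpace_lhom_ext fun j₁ j₂ j₃ => ?_) f
  simp only [LinearMap.comp_apply, pieriOp₁₂_tripleVec, pieriOp₁₃_tripleVec, map_sum, map_smul]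
  exact (pieri_comm tripleVec j₁ j₂ j₃).symm

theorem pieriOp₁₂_comm_pieriOp₂₃ (f : TripleSpace) :
    pieriOp₁₂ (pieriOp₂₃ f) = pieriOp₂₃ (pieriOp₁₂ f) := by
  refine LinearMap.congr_fun (f := pieriOp₁₂ ∘ₗ pieriOp₂₃) (g := pieriOp₂₃ ∘ₗ pieriOp₁₂)
    (tripleSpace_lhom_ext fun j₁ j₂ j₃ => ?_) f
  have h (j₁ j₂ j₃ : ℤ) : pieriOp₁₂ (tripleVec j₁ j₂ j₃) =
      ∑ b ∈ ({-1, 1} : Finset ℤ), ∑ a ∈ ({-1, 1} : Finset ℤ),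
        pieriCoeff b a j₂ j₁ j₃ • tripleVec (j₁ + a) (j₂ + b) j₃ := by
    rw [pieriOp₁₂_tripleVec, Finset.sum_comm]
    simp only [pieriCoeff_symm _ _ j₁ j₂]
  simp only [LinearMap.comp_apply, h, pieriOp₂₃_tripleVec, map_sum, map_smul]
  exact (pieri_comm (fun j₁ j₂ j₃ => tripleVec j₂ j₁ j₃) j₂ j₁ j₃).symm

theorem pieriOp₁₃_comm_pieriOp₂₃ (f : TripleSpace) :
    pieriOp₁₃ (pieriOp₂₃ f) = pieriOp₂₃ (pieriOp₁₃ f) := by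
  refine LinearMap.congr_fun (f := pieriOp₁₃ ∘ₗ pieriOp₂₃) (g := pieriOp₂₃ ∘ₗ pieriOp₁₃)
    (tripleSpace_lhom_ext fun j₁ j₂ j₃ => ?_) f
  have h (j₁ j₂ j₃ : ℤ) : pieriOp₁₃ (tripleVec j₁ j₂ j₃) =
      ∑ b ∈ ({-1, 1} : Finset ℤ), ∑ a ∈ ({-1, 1} : Finset ℤ),
        pieriCoeff b a j₃ j₁ j₂ • tripleVec (j₁ + a) j₂ (j₃ + b) := by
    rw [pieriOp₁₃_tripleVec, Finset.sum_comm]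
    simp only [pieriCoeff_symm _ _ j₁ j₃]
  have h' (j₁ j₂ j₃ : ℤ) : pieriOp₂₃ (tripleVec j₁ j₂ j₃) =
      ∑ b ∈ ({-1, 1} : Finset ℤ), ∑ a ∈ ({-1, 1} : Finset ℤ),
        pieriCoeff b a j₃ j₂ j₁ • tripleVec j₁ (j₂ + a) (j₃ + b) := by
    rw [pieriOp₂₃_tripleVec, Finset.sum_comm]
    simp only [pieriCoeff_symm _ _ j₂ j₃]
  simp only [LinearMap.comp_apply, h, h', map_sum, map_smul]
  -- The index shared by both rules, here j₃, must come first in `pieri_comm`.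
  exact (pieri_comm (fun j₃ j₁ j₂ => tripleVec j₁ j₂ j₃) j₃ j₁ j₂).symm

theorem tripleVec_apply (j₁ j₂ j₃ k₁ k₂ k₃ : ℤ) : tripleVec j₁ j₂ j₃ (k₁, k₂, k₃) =
    if j₁ = k₁ ∧ j₂ = k₂ ∧ j₃ = k₃ then 1 else 0 := by
  simp [tripleVec, Finsupp.single_apply]

theorem pieriOp₁₂_apply (f : TripleSpace) (k₁ k₂ k₃ : ℤ) : pieriOp₁₂ f (k₁, k₂, k₃) =
    ∑ a ∈ ({-1, 1} : Finset ℤ), ∑ b ∈ ({-1, 1} : Finset ℤ),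
      pieriCoeff a b (k₁ - a) (k₂ - b) k₃ * f (k₁ - a, k₂ - b, k₃) := by
  have h : Finsupp.lapply (k₁, k₂, k₃) ∘ₗ pieriOp₁₂ =
      ∑ a ∈ ({-1, 1} : Finset ℤ), ∑ b ∈ ({-1, 1} : Finset ℤ),
        pieriCoeff a b (k₁ - a) (k₂ - b) k₃ • Finsupp.lapply (k₁ - a, k₂ - b, k₃) := by
    refine tripleSpace_lhom_ext fun j₁ j₂ j₃ => ?_
    simp only [LinearMap.comp_apply, pieriOp₁₂_tripleVec, map_sum, map_smul, LinearMap.sum_apply,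
      LinearMap.smul_apply, Finsupp.lapply_apply, tripleVec_apply]
    refine Finset.sum_congr rfl fun a _ => Finset.sum_congr rfl fun b _ => ?_
    by_cases hc : j₁ + a = k₁ ∧ j₂ + b = k₂ ∧ j₃ = k₃
    · obtain ⟨rfl, rfl, rfl⟩ := hc
      simp
    · rw [if_neg hc, if_neg (by omega), smul_zero, smul_zero]
  simpa using LinearMap.congr_fun h f

theorem pieriOp₁₃_apply (f : TripleSpace) (k₁ k₂ k₃ : ℤ) : pieriOp₁₃ f (k₁, k₂, k₃) =
    ∑ a ∈ ({-1, 1} : Finset ℤ), ∑ b ∈ ({-1, 1} : Finset ℤ),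
      pieriCoeff a b (k₁ - a) (k₃ - b) k₂ * f (k₁ - a, k₂, k₃ - b) := by
  have h : Finsupp.lapply (k₁, k₂, k₃) ∘ₗ pieriOp₁₃ =
      ∑ a ∈ ({-1, 1} : Finset ℤ), ∑ b ∈ ({-1, 1} : Finset ℤ),
        pieriCoeff a b (k₁ - a) (k₃ - b) k₂ • Finsupp.lapply (k₁ - a, k₂, k₃ - b) := by
    refine tripleSpace_lhom_ext fun j₁ j₂ j₃ => ?_
    simp only [LinearMap.comp_apply, pieriOp₁₃_tripleVec, map_sum, map_smul, LinearMap.sum_apply,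
      LinearMap.smul_apply, Finsupp.lapply_apply, tripleVec_apply]
    refine Finset.sum_congr rfl fun a _ => Finset.sum_congr rfl fun b _ => ?_
    by_cases hc : j₁ + a = k₁ ∧ j₂ = k₂ ∧ j₃ + b = k₃
    · obtain ⟨rfl, rfl, rfl⟩ := hc
      simp
    · rw [if_neg hc, if_neg (by omega), smul_zero, smul_zero]
  simpa using LinearMap.congr_fun h f

theorem pieriOp₂₃_apply (f : TripleSpace) (k₁ k₂ k₃ : ℤ) : pieriOp₂₃ f (k₁, k₂, k₃) =
    ∑ a ∈ ({-1, 1} : Finset ℤ), ∑ b ∈ ({-1, 1} : Finset ℤ),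
      pieriCoeff a b (k₂ - a) (k₃ - b) k₁ * f (k₁, k₂ - a, k₃ - b) := by
  have h : Finsupp.lapply (k₁, k₂, k₃) ∘ₗ pieriOp₂₃ =
      ∑ a ∈ ({-1, 1} : Finset ℤ), ∑ b ∈ ({-1, 1} : Finset ℤ),
        pieriCoeff a b (k₂ - a) (k₃ - b) k₁ • Finsupp.lapply (k₁, k₂ - a, k₃ - b) := by
    refine tripleSpace_lhom_ext fun j₁ j₂ j₃ => ?_
    simp only [LinearMap.comp_apply, pieriOp₂₃_tripleVec, map_sum, map_smul, LinearMap.sum_apply,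
      LinearMap.smul_apply, Finsupp.lapply_apply, tripleVec_apply]
    refine Finset.sum_congr rfl fun a _ => Finset.sum_congr rfl fun b _ => ?_
    by_cases hc : j₁ = k₁ ∧ j₂ + a = k₂ ∧ j₃ + b = k₃
    · obtain ⟨rfl, rfl, rfl⟩ := hc
      simp
    · rw [if_neg hc, if_neg (by omega), smul_zero, smul_zero]
  simpa using LinearMap.congr_fun h f

/-! ### Leading triples and freeness of the polynomial action. -/

/-- The vector `f` has leading triple `(a + b, a + c, b + c)`. -/
def HasLeadingTriple (a b c : ℕ) (f : TripleSpace) : Prop :=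
  ∀ j₁ j₂ j₃ : ℤ, 2 * ((a : ℤ) + b + c) ≤ j₁ + j₂ + j₃ →
    (f (j₁, j₂, j₃) ≠ 0 ↔ j₁ = a + b ∧ j₂ = a + c ∧ j₃ = b + c)

theorem HasLeadingTriple.eq_zero {a b c : ℕ} {f : TripleSpace} (h : HasLeadingTriple a b c f)
    {j₁ j₂ j₃ : ℤ} (hj : 2 * ((a : ℤ) + b + c) < j₁ + j₂ + j₃) : f (j₁, j₂, j₃) = 0 := by
  by_contra hf
  have := (h j₁ j₂ j₃ hj.le).1 hf
  omega

/-- At index sums from the new leading degree upwards only the raise-raise term contributes, with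
nonzero coefficient. -/
theorem HasLeadingTriple.pieriOp₁₂ {a b c : ℕ} {f : TripleSpace} (h : HasLeadingTriple a b c f) :
    HasLeadingTriple (a + 1) b c (pieriOp₁₂ f) := by
  intro j₁ j₂ j₃ hj
  push_cast at hj ⊢
  simp (disch := omega) only [pieriOp₁₂_apply, Finset.sum_pair (show (-1 : ℤ) ≠ 1 by decide),
    h.eq_zero, mul_zero, zero_add]
  rw [mul_ne_zero_iff, and_iff_right (pieriCoeff_raise_raise_ne_zero _ _ _), h _ _ _ (by omega)]
  omega

theorem HasLeadingTriple.pieriOp₁₃ {a b c : ℕ} {f : TripleSpace} (h : HasLeadingTriple a b c f) :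
    HasLeadingTriple a (b + 1) c (pieriOp₁₃ f) := by
  intro j₁ j₂ j₃ hj
  push_cast at hj ⊢
  simp (disch := omega) only [pieriOp₁₃_apply, Finset.sum_pair (show (-1 : ℤ) ≠ 1 by decide),
    h.eq_zero, mul_zero, zero_add]
  rw [mul_ne_zero_iff, and_iff_right (pieriCoeff_raise_raise_ne_zero _ _ _), h _ _ _ (by omega)]
  omega

theorem HasLeadingTriple.pieriOp₂₃ {a b c : ℕ} {f : TripleSpace} (h : HasLeadingTriple a b c f) :
    HasLeadingTriple a b (c + 1) (pieriOp₂₃ f) := by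
  intro j₁ j₂ j₃ hj
  push_cast at hj ⊢
  simp (disch := omega) only [pieriOp₂₃_apply, Finset.sum_pair (show (-1 : ℤ) ≠ 1 by decide),
    h.eq_zero, mul_zero, zero_add]
  rw [mul_ne_zero_iff, and_iff_right (pieriCoeff_raise_raise_ne_zero _ _ _), h _ _ _ (by omega)]
  omega

/-- The action of the monomial `X₁₂ᵃ X₁₃ᵇ X₂₃ᶜ` on the basis vector of `(0, 0, 0)`. -/
def monomialVec (m : ℕ × ℕ × ℕ) : TripleSpace :=
  pieriOp₁₂^[m.1] (pieriOp₁₃^[m.2.1] (pieriOp₂₃^[m.2.2] (tripleVec 0 0 0)))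

theorem hasLeadingTriple_monomialVec (a b c : ℕ) :
    HasLeadingTriple a b c (monomialVec (a, b, c)) := by
  have h0 : HasLeadingTriple 0 0 0 (tripleVec 0 0 0) := by
    intro j₁ j₂ j₃ _
    simp only [tripleVec_apply, ne_eq, ite_eq_right_iff, one_ne_zero, imp_false, not_not,
      Nat.cast_zero, add_zero]
    omega
  have h1 : HasLeadingTriple 0 0 c (pieriOp₂₃^[c] (tripleVec 0 0 0)) := by
    induction c with
    | zero => rwa [Function.iterate_zero_apply]
    | succ c ih => rw [Function.iterate_succ_apply']; exact ih.pieriOp₂₃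
  have h2 : HasLeadingTriple 0 b c (pieriOp₁₃^[b] (pieriOp₂₃^[c] (tripleVec 0 0 0))) := by
    induction b with
    | zero => rwa [Function.iterate_zero_apply]
    | succ b ih => rw [Function.iterate_succ_apply']; exact ih.pieriOp₁₃
  simp only [monomialVec]
  induction a with
  | zero => rwa [Function.iterate_zero_apply]
  | succ a ih => rw [Function.iterate_succ_apply']; exact ih.pieriOp₁₂

/-- Polynomials in three commuting variables, applied to the basis vector of `(0, 0, 0)`. -/
def polyVec : ((ℕ × ℕ × ℕ) →₀ GroundField) →ₗ[GroundField] TripleSpace :=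
  Finsupp.linearCombination GroundField monomialVec

/-- A monomial of maximal degree in p contributes at its leading triple, and no other monomial of p
does, since (a+b, a+c, b+c) determines (a,b,c). -/
theorem polyVec_injective : Function.Injective polyVec := by
  rw [← LinearMap.ker_eq_bot, LinearMap.ker_eq_bot']
  intro p hp
  by_contra hne
  obtain ⟨m, hm, hmax⟩ := Finset.exists_max_image p.support (fun m => m.1 + m.2.1 + m.2.2)
    (Finsupp.support_nonempty_iff.2 hne)
  obtain ⟨a, b, c⟩ := m
  have h1 := DFunLike.congr_fun hp ((a : ℤ) + b, (a : ℤ) + c, (b : ℤ) + c)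
  rw [polyVec, Finsupp.linearCombination_apply, Finsupp.sum, Finsupp.finsetSum_apply,
    Finset.sum_eq_single (a, b, c)] at h1
  · have h2 := (hasLeadingTriple_monomialVec a b c (a + b) (a + c) (b + c) (by omega)).2 (by simp)
    simp only [Finsupp.smul_apply, smul_eq_mul, Finsupp.zero_apply, mul_eq_zero, h2,
      or_false] at h1
    exact Finsupp.mem_support_iff.1 hm h1
  · rintro ⟨a', b', c'⟩ hm' hne'
    have hle := hmax _ hm'
    simp only at hle
    rw [Finsupp.smul_apply, smul_eq_zero]
    right
    by_contra h3
    have h4 := (hasLeadingTriple_monomialVec a' b' c' _ _ _ (by omega)).1 h3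
    apply hne'
    simp only [Prod.mk.injEq]
    omega
  · intro h
    exact absurd hm h

theorem pieriOp₁₂_monomialVec (a b c : ℕ) :
    pieriOp₁₂ (monomialVec (a, b, c)) = monomialVec (a + 1, b, c) := by
  simp only [monomialVec, Function.iterate_succ_apply']

theorem pieriOp₁₃_monomialVec (a b c : ℕ) :
    pieriOp₁₃ (monomialVec (a, b, c)) = monomialVec (a, b + 1, c) := by
  have h : Function.Commute pieriOp₁₂ pieriOp₁₃ := pieriOp₁₂_comm_pieriOp₁₃
  simp only [monomialVec, Function.iterate_succ_apply']
  exact ((h.iterate_left a).eq _).symm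

theorem pieriOp₂₃_monomialVec (a b c : ℕ) :
    pieriOp₂₃ (monomialVec (a, b, c)) = monomialVec (a, b, c + 1) := by
  have h : Function.Commute pieriOp₁₂ pieriOp₂₃ := pieriOp₁₂_comm_pieriOp₂₃
  have h' : Function.Commute pieriOp₁₃ pieriOp₂₃ := pieriOp₁₃_comm_pieriOp₂₃
  simp only [monomialVec, Function.iterate_succ_apply']
  rw [← (h.iterate_left a).eq, ← (h'.iterate_left b).eq]

/-! ### Polynomials, and their evaluation at the symmetric variables. -/

/-- Polynomials in three variables, as a space with a basis of monomials. -/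
abbrev PolySpace : Type := (ℕ × ℕ × ℕ) →₀ GroundField

/-- Evaluation of polynomials at the symmetric variables. -/
def polyEval : PolySpace →ₗ[GroundField] Laurent :=
  Finsupp.linearCombination GroundField fun m => xsym 0 ^ m.1 * xsym 1 ^ m.2.1 * xsym 2 ^ m.2.2

/-- Multiplication by the first variable. -/
def polyMul₁₂ : PolySpace →ₗ[GroundField] PolySpace :=
  Finsupp.lmapDomain GroundField GroundField fun m => (m.1 + 1, m.2.1, m.2.2)

/-- Multiplication by the second variable. -/
def polyMul₁₃ : PolySpace →ₗ[GroundField] PolySpace :=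
  Finsupp.lmapDomain GroundField GroundField fun m => (m.1, m.2.1 + 1, m.2.2)

/-- Multiplication by the third variable. -/
def polyMul₂₃ : PolySpace →ₗ[GroundField] PolySpace :=
  Finsupp.lmapDomain GroundField GroundField fun m => (m.1, m.2.1, m.2.2 + 1)

theorem polyVec_polyMul₁₂ (p : PolySpace) : polyVec (polyMul₁₂ p) = pieriOp₁₂ (polyVec p) := by
  refine LinearMap.congr_fun (f := polyVec ∘ₗ polyMul₁₂) (g := pieriOp₁₂ ∘ₗ polyVec)
    (Finsupp.lhom_ext fun ⟨a, b, c⟩ r => ?_) p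
  simp [polyVec, polyMul₁₂, Finsupp.mapDomain_single, pieriOp₁₂_monomialVec]

theorem polyVec_polyMul₁₃ (p : PolySpace) : polyVec (polyMul₁₃ p) = pieriOp₁₃ (polyVec p) := by
  refine LinearMap.congr_fun (f := polyVec ∘ₗ polyMul₁₃) (g := pieriOp₁₃ ∘ₗ polyVec)
    (Finsupp.lhom_ext fun ⟨a, b, c⟩ r => ?_) p
  simp [polyVec, polyMul₁₃, Finsupp.mapDomain_single, pieriOp₁₃_monomialVec]

theorem polyVec_polyMul₂₃ (p : PolySpace) : polyVec (polyMul₂₃ p) = pieriOp₂₃ (polyVec p) := by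
  refine LinearMap.congr_fun (f := polyVec ∘ₗ polyMul₂₃) (g := pieriOp₂₃ ∘ₗ polyVec)
    (Finsupp.lhom_ext fun ⟨a, b, c⟩ r => ?_) p
  simp [polyVec, polyMul₂₃, Finsupp.mapDomain_single, pieriOp₂₃_monomialVec]

theorem polyEval_polyMul₁₂ (p : PolySpace) : polyEval (polyMul₁₂ p) = xsym 0 * polyEval p := by
  refine LinearMap.congr_fun (f := polyEval ∘ₗ polyMul₁₂)
    (g := LinearMap.mulLeft GroundField (xsym 0) ∘ₗ polyEval) (Finsupp.lhom_ext fun m r => ?_) p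
  simp only [LinearMap.comp_apply, polyEval, polyMul₁₂, Finsupp.lmapDomain_apply,
    Finsupp.mapDomain_single, Finsupp.linearCombination_single, LinearMap.mulLeft_apply,
    mul_smul_comm]
  congr 1
  ring

theorem polyEval_polyMul₁₃ (p : PolySpace) : polyEval (polyMul₁₃ p) = xsym 1 * polyEval p := by
  refine LinearMap.congr_fun (f := polyEval ∘ₗ polyMul₁₃)
    (g := LinearMap.mulLeft GroundField (xsym 1) ∘ₗ polyEval) (Finsupp.lhom_ext fun m r => ?_) p
  simp only [LinearMap.comp_apply, polyEval, polyMul₁₃, Finsupp.lmapDomain_apply,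
    Finsupp.mapDomain_single, Finsupp.linearCombination_single, LinearMap.mulLeft_apply,
    mul_smul_comm]
  congr 1
  ring

theorem polyEval_polyMul₂₃ (p : PolySpace) : polyEval (polyMul₂₃ p) = xsym 2 * polyEval p := by
  refine LinearMap.congr_fun (f := polyEval ∘ₗ polyMul₂₃)
    (g := LinearMap.mulLeft GroundField (xsym 2) ∘ₗ polyEval) (Finsupp.lhom_ext fun m r => ?_) p
  simp only [LinearMap.comp_apply, polyEval, polyMul₂₃, Finsupp.lmapDomain_apply,
    Finsupp.mapDomain_single, Finsupp.linearCombination_single, LinearMap.mulLeft_apply,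
    mul_smul_comm]
  congr 1
  ring

/-! ### Induction over admissible triples, and existence. -/

theorem Admissible.nonneg {j₁ j₂ j₃ : ℤ} (h : Admissible j₁ j₂ j₃) : 0 ≤ j₁ + j₂ + j₃ := by
  unfold Admissible at h
  omega

/-- An admissible triple other than `(0, 0, 0)` is obtained from a smaller one by raising two of
its indices. -/
theorem Admissible.exists_lower {j₁ j₂ j₃ : ℤ} (h : Admissible j₁ j₂ j₃) :
    (j₁ = 0 ∧ j₂ = 0 ∧ j₃ = 0) ∨ Admissible (j₁ - 1) (j₂ - 1) j₃ ∨
      Admissible (j₁ - 1) j₂ (j₃ - 1) ∨ Admissible j₁ (j₂ - 1) (j₃ - 1) := by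
  unfold Admissible at *
  simp only [Int.even_iff, abs_le] at *
  omega

/-- Induction over the admissible triples along their Pieri rules. -/
theorem Admissible.induction {P : ℤ → ℤ → ℤ → Prop} (h0 : P 0 0 0)
    (h₁₂ : ∀ j₁ j₂ j₃, Admissible j₁ j₂ j₃ → (∀ k₁ k₂ k₃, Admissible k₁ k₂ k₃ →
      k₁ + k₂ + k₃ < j₁ + j₂ + j₃ + 2 → P k₁ k₂ k₃) → P (j₁ + 1) (j₂ + 1) j₃)
    (h₁₃ : ∀ j₁ j₂ j₃, Admissible j₁ j₂ j₃ → (∀ k₁ k₂ k₃, Admissible k₁ k₂ k₃ →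
      k₁ + k₂ + k₃ < j₁ + j₂ + j₃ + 2 → P k₁ k₂ k₃) → P (j₁ + 1) j₂ (j₃ + 1))
    (h₂₃ : ∀ j₁ j₂ j₃, Admissible j₁ j₂ j₃ → (∀ k₁ k₂ k₃, Admissible k₁ k₂ k₃ →
      k₁ + k₂ + k₃ < j₁ + j₂ + j₃ + 2 → P k₁ k₂ k₃) → P j₁ (j₂ + 1) (j₃ + 1))
    {j₁ j₂ j₃ : ℤ} (h : Admissible j₁ j₂ j₃) : P j₁ j₂ j₃ := by
  induction hn : (j₁ + j₂ + j₃).toNat using Nat.strong_induction_on generalizing j₁ j₂ j₃ with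
  | _ n ih =>
  have ih' (k₁ k₂ k₃ : ℤ) (hk : Admissible k₁ k₂ k₃) (hlt : k₁ + k₂ + k₃ < j₁ + j₂ + j₃) :
      P k₁ k₂ k₃ := by
    have := hk.nonneg
    exact ih _ (by omega) hk rfl
  obtain ⟨rfl, rfl, rfl⟩ | h' | h' | h' := h.exists_lower
  · exact h0
  · simpa using h₁₂ _ _ _ h' fun _ _ _ hk hlt => ih' _ _ _ hk (by omega)
  · simpa using h₁₃ _ _ _ h' fun _ _ _ hk hlt => ih' _ _ _ hk (by omega)
  · simpa using h₂₃ _ _ _ h' fun _ _ _ hk hlt => ih' _ _ _ hk (by omega)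

/-- If a Pieri sum and all its terms but the leading one lie in a subspace, then so does the
leading term. -/
theorem mem_of_pieri_sum_mem {M : Type*} [AddCommGroup M] [Module GroundField M]
    (S : Submodule GroundField M) {j₁ j₂ j₃ : ℤ} {f : ℤ → ℤ → M}
    (h : ∑ a ∈ ({-1, 1} : Finset ℤ), ∑ b ∈ ({-1, 1} : Finset ℤ),
      pieriCoeff a b j₁ j₂ j₃ • f a b ∈ S)
    (hf : ∀ a b : ℤ, a ∈ ({-1, 1} : Finset ℤ) → b ∈ ({-1, 1} : Finset ℤ) → a + b < 2 →
      pieriCoeff a b j₁ j₂ j₃ • f a b ∈ S) : f 1 1 ∈ S := by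
  simp only [Finset.sum_pair (show (-1 : ℤ) ≠ 1 by decide)] at h
  have m1 := hf (-1) (-1) (by simp) (by simp) (by decide)
  have m2 := hf (-1) 1 (by simp) (by simp) (by decide)
  have m3 := hf 1 (-1) (by simp) (by simp) (by decide)
  have h1 := (S.add_mem_iff_right m3).1 ((S.add_mem_iff_right (S.add_mem m1 m2)).1 h)
  exact (S.smul_mem_iff (pieriCoeff_raise_raise_ne_zero _ _ _)).1 h1

/-- The range is stable under the Pieri operators, so a Pieri rule expresses its leading vector
through vectors already in the range. Inadmissible terms have coefficient zero. -/
theorem tripleVec_mem_range {j₁ j₂ j₃ : ℤ} (h : Admissible j₁ j₂ j₃) :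
    tripleVec j₁ j₂ j₃ ∈ LinearMap.range polyVec := by
  refine Admissible.induction (P := fun j₁ j₂ j₃ => tripleVec j₁ j₂ j₃ ∈ LinearMap.range polyVec)
    ⟨Finsupp.single (0, 0, 0) 1, by simp [polyVec, monomialVec]⟩ ?_ ?_ ?_ h
  · intro j₁ j₂ j₃ hj ih
    obtain ⟨p, hp⟩ := ih _ _ _ hj (by omega)
    refine mem_of_pieri_sum_mem (LinearMap.range polyVec) (j₁ := j₁) (j₂ := j₂) (j₃ := j₃)
      (f := fun a b => tripleVec (j₁ + a) (j₂ + b) j₃) ⟨polyMul₁₂ p, ?_⟩ fun a b ha hb hab => ?_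
    · rw [polyVec_polyMul₁₂, hp, pieriOp₁₂_tripleVec]
    · by_cases h' : Admissible (j₁ + a) (j₂ + b) j₃
      · exact Submodule.smul_mem _ _ (ih _ _ _ h' (by omega))
      · rw [pieriCoeff_eq_zero ha hb hj h', zero_smul]
        exact Submodule.zero_mem _
  · intro j₁ j₂ j₃ hj ih
    obtain ⟨p, hp⟩ := ih _ _ _ hj (by omega)
    refine mem_of_pieri_sum_mem (LinearMap.range polyVec) (j₁ := j₁) (j₂ := j₃) (j₃ := j₂)
      (f := fun a b => tripleVec (j₁ + a) j₂ (j₃ + b)) ⟨polyMul₁₃ p, ?_⟩ fun a b ha hb hab => ?_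
    · rw [polyVec_polyMul₁₃, hp, pieriOp₁₃_tripleVec]
    · by_cases h' : Admissible (j₁ + a) j₂ (j₃ + b)
      · exact Submodule.smul_mem _ _ (ih _ _ _ h' (by omega))
      · rw [pieriCoeff_eq_zero ha hb hj.swap₂₃ fun h => h' h.swap₂₃, zero_smul]
        exact Submodule.zero_mem _
  · intro j₁ j₂ j₃ hj ih
    obtain ⟨p, hp⟩ := ih _ _ _ hj (by omega)
    refine mem_of_pieri_sum_mem (LinearMap.range polyVec) (j₁ := j₂) (j₂ := j₃) (j₃ := j₁)
      (f := fun a b => tripleVec j₁ (j₂ + a) (j₃ + b)) ⟨polyMul₂₃ p, ?_⟩ fun a b ha hb hab => ?_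
    · rw [polyVec_polyMul₂₃, hp, pieriOp₂₃_tripleVec]
    · by_cases h' : Admissible j₁ (j₂ + a) (j₃ + b)
      · exact Submodule.smul_mem _ _ (ih _ _ _ h' (by omega))
      · rw [pieriCoeff_eq_zero ha hb hj.swap₁₂.swap₂₃ fun h => h' h.swap₂₃.swap₁₂, zero_smul]
        exact Submodule.zero_mem _

/-- A Pieri sum may be computed with any family that agrees with the given one at the admissible
triples. -/
theorem pieri_sum_congr {M : Type*} [AddCommGroup M] [Module GroundField M] {j₁ j₂ j₃ : ℤ}
    (hj : Admissible j₁ j₂ j₃) {f g : ℤ → ℤ → M}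
    (h : ∀ a b, Admissible (j₁ + a) (j₂ + b) j₃ → f a b = g a b) :
    ∑ a ∈ ({-1, 1} : Finset ℤ), ∑ b ∈ ({-1, 1} : Finset ℤ), pieriCoeff a b j₁ j₂ j₃ • f a b =
    ∑ a ∈ ({-1, 1} : Finset ℤ), ∑ b ∈ ({-1, 1} : Finset ℤ),
      pieriCoeff a b j₁ j₂ j₃ • g a b := by
  refine Finset.sum_congr rfl fun a ha => Finset.sum_congr rfl fun b hb => ?_
  by_cases h' : Admissible (j₁ + a) (j₂ + b) j₃
  · rw [h a b h']
  · rw [pieriCoeff_eq_zero ha hb hj h', zero_smul, zero_smul]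

/-- The Pieri rules hold already between the abstract polynomials, by injectivity of `polyVec`;
evaluation carries them to Laurent polynomials and need not be injective. -/
theorem exists_isGenusTwoMacdonald : ∃ Ψ : ℤ → ℤ → ℤ → Laurent, IsGenusTwoMacdonald Ψ := by
  have h (j₁ j₂ j₃ : ℤ) : ∃ p : PolySpace, (Admissible j₁ j₂ j₃ → polyVec p = tripleVec j₁ j₂ j₃) ∧
      (¬ Admissible j₁ j₂ j₃ → p = 0) := by
    by_cases hj : Admissible j₁ j₂ j₃
    · obtain ⟨p, hp⟩ := tripleVec_mem_range hj
      exact ⟨p, fun _ => hp, fun h => absurd hj h⟩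
    · exact ⟨0, fun h => absurd h hj, fun _ => rfl⟩
  choose p hp hp0 using h
  refine ⟨fun j₁ j₂ j₃ => polyEval (p j₁ j₂ j₃), ?_, ?_, ?_, ?_, ?_⟩
  · intro j₁ j₂ j₃ hj
    simp only [← polyEval_polyMul₁₂, ← map_smul, ← map_sum]
    congr 1
    apply polyVec_injective
    rw [polyVec_polyMul₁₂, hp _ _ _ hj, pieriOp₁₂_tripleVec]
    simp only [map_sum, map_smul]
    exact pieri_sum_congr hj fun a b h' => (hp _ _ _ h').symm
  · intro j₁ j₂ j₃ hj
    simp only [← polyEval_polyMul₁₃, ← map_smul, ← map_sum]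
    congr 1
    apply polyVec_injective
    rw [polyVec_polyMul₁₃, hp _ _ _ hj, pieriOp₁₃_tripleVec]
    simp only [map_sum, map_smul]
    exact pieri_sum_congr hj.swap₂₃ fun a b h' => (hp _ _ _ h'.swap₂₃).symm
  · intro j₁ j₂ j₃ hj
    simp only [← polyEval_polyMul₂₃, ← map_smul, ← map_sum]
    congr 1
    apply polyVec_injective
    rw [polyVec_polyMul₂₃, hp _ _ _ hj, pieriOp₂₃_tripleVec]
    simp only [map_sum, map_smul]
    exact pieri_sum_congr hj.swap₁₂.swap₂₃ fun a b h' => (hp _ _ _ h'.swap₂₃.swap₁₂).symm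
  · intro j₁ j₂ j₃ hj
    simp only [hp0 _ _ _ hj, map_zero]
  · have h1 : p 0 0 0 = Finsupp.single (0, 0, 0) 1 := by
      apply polyVec_injective
      rw [hp _ _ _ admissible_zero]
      simp [polyVec, monomialVec]
    simp [h1, polyEval]

/-! ### Uniqueness. -/

namespace IsGenusTwoMacdonald

variable {Ψ Ψ' : ℤ → ℤ → ℤ → Laurent}

theorem eq_of_admissible (h : IsGenusTwoMacdonald Ψ) (h' : IsGenusTwoMacdonald Ψ') {j₁ j₂ j₃ : ℤ}
    (hj : Admissible j₁ j₂ j₃) : Ψ j₁ j₂ j₃ = Ψ' j₁ j₂ j₃ := by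
  have hbot {f g : Laurent} (e : f = g) (c : GroundField) :
      c • (f - g) ∈ (⊥ : Submodule GroundField Laurent) := by
    rw [e, sub_self, smul_zero]
    exact Submodule.zero_mem _
  have key (k₁ k₂ k₃ : ℤ) (s : ℤ) (ih : ∀ k₁ k₂ k₃ : ℤ, Admissible k₁ k₂ k₃ →
      k₁ + k₂ + k₃ < s → Ψ k₁ k₂ k₃ = Ψ' k₁ k₂ k₃) (hs : k₁ + k₂ + k₃ < s) :
      Ψ k₁ k₂ k₃ = Ψ' k₁ k₂ k₃ := by
    by_cases hk : Admissible k₁ k₂ k₃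
    · exact ih _ _ _ hk hs
    · rw [h.eq_zero _ _ _ hk, h'.eq_zero _ _ _ hk]
  refine Admissible.induction (P := fun j₁ j₂ j₃ => Ψ j₁ j₂ j₃ = Ψ' j₁ j₂ j₃)
    (h.eq_one.trans h'.eq_one.symm) ?_ ?_ ?_ hj
  · intro j₁ j₂ j₃ hj ih
    rw [← sub_eq_zero, ← Submodule.mem_bot GroundField]
    -- The difference of the two families satisfies the same rule; membership in the zero subspace
    -- passes to its leading term.
    refine mem_of_pieri_sum_mem ⊥ (j₁ := j₁) (j₂ := j₂) (j₃ := j₃)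
      (f := fun a b => Ψ (j₁ + a) (j₂ + b) j₃ - Ψ' (j₁ + a) (j₂ + b) j₃) ?_
      fun a b ha hb hab => hbot (key _ _ _ _ ih (by omega)) _
    simp only [smul_sub, Finset.sum_sub_distrib, ← h.pieri₁₂ _ _ _ hj, ← h'.pieri₁₂ _ _ _ hj,
      ih _ _ _ hj (by omega), sub_self, Submodule.zero_mem]
  · intro j₁ j₂ j₃ hj ih
    rw [← sub_eq_zero, ← Submodule.mem_bot GroundField]
    refine mem_of_pieri_sum_mem ⊥ (j₁ := j₁) (j₂ := j₃) (j₃ := j₂)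
      (f := fun a b => Ψ (j₁ + a) j₂ (j₃ + b) - Ψ' (j₁ + a) j₂ (j₃ + b)) ?_
      fun a b ha hb hab => hbot (key _ _ _ _ ih (by omega)) _
    simp only [smul_sub, Finset.sum_sub_distrib, ← h.pieri₁₃ _ _ _ hj, ← h'.pieri₁₃ _ _ _ hj,
      ih _ _ _ hj (by omega), sub_self, Submodule.zero_mem]
  · intro j₁ j₂ j₃ hj ih
    rw [← sub_eq_zero, ← Submodule.mem_bot GroundField]
    refine mem_of_pieri_sum_mem ⊥ (j₁ := j₂) (j₂ := j₃) (j₃ := j₁)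
      (f := fun a b => Ψ j₁ (j₂ + a) (j₃ + b) - Ψ' j₁ (j₂ + a) (j₃ + b)) ?_
      fun a b ha hb hab => hbot (key _ _ _ _ ih (by omega)) _
    simp only [smul_sub, Finset.sum_sub_distrib, ← h.pieri₂₃ _ _ _ hj, ← h'.pieri₂₃ _ _ _ hj,
      ih _ _ _ hj (by omega), sub_self, Submodule.zero_mem]

theorem unique (h : IsGenusTwoMacdonald Ψ) (h' : IsGenusTwoMacdonald Ψ') : Ψ = Ψ' := by
  funext j₁ j₂ j₃
  by_cases hj : Admissible j₁ j₂ j₃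
  · exact h.eq_of_admissible h' hj
  · rw [h.eq_zero _ _ _ hj, h'.eq_zero _ _ _ hj]

theorem pieriFamily (h : IsGenusTwoMacdonald Ψ) :
    PieriFamily (xs 0) (xs 1) (xs 2) (fun j₁ j₂ j₃ => toRatFun (Ψ j₁ j₂ j₃)) where
  pieri₁₂ j₁ j₂ j₃ hj := by
    rw [xs, ← toRatFun_xsym, ← map_mul, h.pieri₁₂ _ _ _ hj]
    simp only [map_sum, map_smul]
  pieri₁₃ j₁ j₂ j₃ hj := by
    rw [xs, ← toRatFun_xsym, ← map_mul, h.pieri₁₃ _ _ _ hj]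
    simp only [map_sum, map_smul]
  pieri₂₃ j₁ j₂ j₃ hj := by
    rw [xs, ← toRatFun_xsym, ← map_mul, h.pieri₂₃ _ _ _ hj]
    simp only [map_sum, map_smul]
  eq_zero j₁ j₂ j₃ hj := by rw [h.eq_zero _ _ _ hj, map_zero]
  eq_one := by rw [h.eq_one, map_one]

end IsGenusTwoMacdonald

/-! ### Nonvanishing of the Macdonald polynomials. -/

theorem eigenvalue_sub_one_sub_eigenvalue_add_one_ne_zero {j : ℤ} :
    eigenvalue (j - 1) - eigenvalue (j + 1) ≠ 0 := by
  have hd := q4_sq_sub_inv_ne_zero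
  have hn : qtHalf (2 * j) 2 ≠ 0 := qtHalf_ne_zero (by simp)
  have h1 := two_mul_eigenvalue_sub (a := 1) (.inr rfl) (j - 1)
  have h2 := eigenvalue_add_one_add_eigenvalue_sub_one j
  rw [sub_add_cancel, ← h2] at h1
  rw [Int.cast_one] at h1
  have h3 : eigenvalue (j - 1) - eigenvalue (j + 1) =
      -((q4 ^ 2 - (q4 ^ 2)⁻¹) ^ 2 * qtHalf (2 * j) 2) := by
    linear_combination h1
  rw [h3]
  exact neg_ne_zero.2 (mul_ne_zero (pow_ne_zero 2 hd) hn)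

theorem pieriCoeff_lower_lower_ne_zero {j₁ j₂ j₃ : ℤ} (h : j₁ + j₂ ≠ j₃) :
    pieriCoeff (-1) (-1) j₁ j₂ j₃ ≠ 0 := by
  have hl (j : ℤ) : lowerFactor j ≠ 0 :=
    div_ne_zero (neg_ne_zero.2 (qtHalf_ne_zero (by simp)))
      (mul_ne_zero (qtHalf_ne_zero (by simp)) (qtHalf_ne_zero (by simp)))
  rw [pieriCoeff_lower_lower]
  exact mul_ne_zero (mul_ne_zero (hl _) (hl _))
    (mul_ne_zero (qtHalf_ne_zero (.inl (by omega))) (qtHalf_ne_zero (by simp)))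

theorem Admissible.raise₁₂ {j₁ j₂ j₃ : ℤ} (h : Admissible j₁ j₂ j₃) :
    Admissible (j₁ + 1) (j₂ + 1) j₃ := by
  unfold Admissible at *
  simp only [Int.even_iff, abs_le] at *
  omega

namespace PieriFamily

variable {u v w : Fin 3} {ψ : ℤ → ℤ → ℤ → RatFun}

/-- The vectors of a family that satisfies the Pieri rules stay nonzero when two indices are
raised, because the difference operators separate the terms of a Pieri rule. -/
theorem raise_ne_zero (huv : u ≠ v) (huw : u ≠ w) (hvw : v ≠ w)
    (h : PieriFamily (xs u) (xs v) (xs w) ψ) {j₁ j₂ j₃ : ℤ} (hj : Admissible j₁ j₂ j₃)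
    (hψ : ψ j₁ j₂ j₃ ≠ 0) : ψ (j₁ + 1) (j₂ + 1) j₃ ≠ 0 := by
  intro h0
  have h1 := h.pieri₁₂ _ _ _ hj.raise₁₂
  have h1' (k₁ k₂ k₃ : ℤ) := h.diffOp_eq_smul huv huw hvw k₁ k₂ k₃
  have h2' (k₁ k₂ k₃ : ℤ) : diffOp u w v (ψ k₁ k₂ k₃) = eigenvalue k₂ • ψ k₁ k₂ k₃ :=
    h.swap₁₂.diffOp_eq_smul huw huv hvw.symm k₂ k₁ k₃
  rw [h0, mul_zero] at h1
  simp only [Finset.sum_pair (show (-1 : ℤ) ≠ 1 by decide)] at h1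
  have e1 := congrArg (diffOp u v w) h1
  simp only [map_add, map_smul, h1', map_zero] at e1
  have s₁ : eigenvalue (j₁ + 1 + -1) - eigenvalue (j₁ + 1 + 1) ≠ 0 :=
    eigenvalue_sub_one_sub_eigenvalue_add_one_ne_zero
  have s₂ : eigenvalue (j₂ + 1 + -1) - eigenvalue (j₂ + 1 + 1) ≠ 0 :=
    eigenvalue_sub_one_sub_eigenvalue_add_one_ne_zero
  -- Applying the operator and subtracting a multiple of the relation eliminates the terms that
  -- raise the first index; the second operator then eliminates those that raise the second.
  have e2 : (eigenvalue (j₁ + 1 + -1) - eigenvalue (j₁ + 1 + 1)) •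
      (pieriCoeff (-1) (-1) (j₁ + 1) (j₂ + 1) j₃ • ψ (j₁ + 1 + -1) (j₂ + 1 + -1) j₃ +
        pieriCoeff (-1) 1 (j₁ + 1) (j₂ + 1) j₃ • ψ (j₁ + 1 + -1) (j₂ + 1 + 1) j₃) = 0 := by
    linear_combination (norm := module) eigenvalue (j₁ + 1 + 1) • h1 - e1
  have e3 := (smul_eq_zero.1 e2).resolve_left s₁
  have e4 := congrArg (diffOp u w v) e3
  simp only [map_add, map_smul, h2', map_zero] at e4
  have e5 : (eigenvalue (j₂ + 1 + -1) - eigenvalue (j₂ + 1 + 1)) •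
      (pieriCoeff (-1) (-1) (j₁ + 1) (j₂ + 1) j₃ • ψ (j₁ + 1 + -1) (j₂ + 1 + -1) j₃) = 0 := by
    linear_combination (norm := module) e4 - eigenvalue (j₂ + 1 + 1) • e3
  -- The coefficient is nonzero because j₃ ≤ j₁ + j₂ keeps the raised triple off the wall.
  have e6 := (smul_eq_zero.1 ((smul_eq_zero.1 e5).resolve_left s₂)).resolve_left
    (pieriCoeff_lower_lower_ne_zero (by unfold Admissible at hj; omega))
  rw [add_neg_cancel_right, add_neg_cancel_right] at e6
  exact hψ e6

theorem ne_zero (huv : u ≠ v) (huw : u ≠ w) (hvw : v ≠ w)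
    (h : PieriFamily (xs u) (xs v) (xs w) ψ) {j₁ j₂ j₃ : ℤ} (hj : Admissible j₁ j₂ j₃) :
    ψ j₁ j₂ j₃ ≠ 0 := by
  refine Admissible.induction (P := fun j₁ j₂ j₃ => ψ j₁ j₂ j₃ ≠ 0) ?_ ?_ ?_ ?_ hj
  · rw [h.eq_one]
    exact one_ne_zero
  · intro j₁ j₂ j₃ hj ih
    exact h.raise_ne_zero huv huw hvw hj (ih _ _ _ hj (by omega))
  · intro j₁ j₂ j₃ hj ih
    exact h.swap₂₃.raise_ne_zero huv.symm hvw huw hj.swap₂₃ (ih _ _ _ hj (by omega))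
  · intro j₁ j₂ j₃ hj ih
    exact h.swap₁₂.swap₂₃.raise_ne_zero huw.symm hvw.symm huv hj.swap₁₂.swap₂₃
      (ih _ _ _ hj (by omega))

end PieriFamily

/-! ### Symmetric Laurent polynomials are generated by the symmetric variables. -/

theorem xpow_mul_xpow (i : Fin 3) (a b : ℤ) : xpow i a * xpow i b = xpow i (a + b) := by
  simp [xpow, AddMonoidAlgebra.single_mul_single, ← Pi.single_add]

theorem inversion_single (u : Fin 3 → ℤˣ) (m : Fin 3 → ℤ) (r : GroundField) :
    inversion u (AddMonoidAlgebra.single m r) =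
      AddMonoidAlgebra.single (fun i => (u i : ℤ) * m i) r := by
  simp [inversion]

theorem inversion_xpow (u : Fin 3 → ℤˣ) (i : Fin 3) (n : ℤ) :
    inversion u (xpow i n) = xpow i (u i * n) := by
  rw [xpow, inversion_single, xpow]
  congr 1
  ext k
  by_cases hk : k = i
  · subst hk
    simp
  · simp [hk]

theorem inversion_xsym (u : Fin 3 → ℤˣ) (i : Fin 3) : inversion u (xsym i) = xsym i := by
  rw [xsym, map_add, inversion_xpow, inversion_xpow]
  rcases Int.units_eq_one_or (u i) with h | h
  · simp [h]
  · simp [h, add_comm]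

theorem xsym_mul_mem_symLaurent (i : Fin 3) {f : Laurent} (hf : f ∈ symLaurent) :
    xsym i * f ∈ symLaurent := fun u => by
  rw [map_mul, inversion_xsym, hf u]

/-- Chebyshev recursion: with p_n = xⁿ + x⁻ⁿ, p_{n+2} = p_1 p_{n+1} - p_n. -/
theorem xpow_add_xpow_neg_mem_adjoin (i : Fin 3) (n : ℤ) :
    xpow i n + xpow i (-n) ∈ Algebra.adjoin GroundField (Set.range xsym) := by
  have hx : xsym i ∈ Algebra.adjoin GroundField (Set.range xsym) :=
    Algebra.subset_adjoin ⟨i, rfl⟩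
  have h0 : xpow i 0 = 1 := by simp [xpow, AddMonoidAlgebra.one_def]
  have h (n : ℕ) : xpow i n + xpow i (-n) ∈ Algebra.adjoin GroundField (Set.range xsym) := by
    induction n using Nat.twoStepInduction with
    | zero =>
      rw [Nat.cast_zero, neg_zero, h0]
      exact add_mem (one_mem _) (one_mem _)
    | one => exact hx
    | more n h1 h2 =>
      have e : xpow i ((n + 2 : ℕ) : ℤ) + xpow i (-((n + 2 : ℕ) : ℤ)) =
          xsym i * (xpow i ((n + 1 : ℕ) : ℤ) + xpow i (-((n + 1 : ℕ) : ℤ))) -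
            (xpow i n + xpow i (-n)) := by
        rw [xsym, add_mul, mul_add, mul_add]
        simp only [xpow_mul_xpow]
        push_cast
        rw [show (1 : ℤ) + (n + 1) = n + 2 by ring, show (1 : ℤ) + -(n + 1) = -n by ring,
          show (-1 : ℤ) + (n + 1) = n by ring, show (-1 : ℤ) + -(n + 1) = -(n + 2) by ring]
        ring
      rw [e]
      exact sub_mem (mul_mem hx h2) h1
  rcases Int.natAbs_eq n with hn | hn
  · rw [hn]
    exact h _
  · rw [hn, neg_neg, add_comm]
    exact h _

theorem prod_xpow (m : Fin 3 → ℤ) : ∏ i, xpow i (m i) = AddMonoidAlgebra.single m 1 := by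
  simp only [Fin.prod_univ_three, xpow, AddMonoidAlgebra.single_mul_single, mul_one]
  congr 1
  ext k
  fin_cases k <;> simp

/-- The sum over all inversions of a monomial factors as the product over i of x_i^{m_i} +
x_i^{-m_i}. -/
theorem sum_inversion_mem_adjoin (f : Laurent) :
    ∑ u : Fin 3 → ℤˣ, inversion u f ∈ Algebra.adjoin GroundField (Set.range xsym) := by
  induction f using AddMonoidAlgebra.induction_linear with
  | zero => simp only [map_zero, Finset.sum_const_zero, zero_mem]
  | add f g hf hg =>
    simp only [map_add, Finset.sum_add_distrib]
    exact add_mem hf hg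
  | single m r =>
    have h : ∑ u : Fin 3 → ℤˣ, inversion u (AddMonoidAlgebra.single m r) =
        r • ∏ i, (xpow i (m i) + xpow i (-m i)) := by
      have h1 (i : Fin 3) : xpow i (m i) + xpow i (-m i) =
          ∑ e : ℤˣ, xpow i (e * m i) := by
        rw [UnitsInt.univ, Finset.sum_pair (by decide)]
        simp
      simp only [h1, Finset.prod_univ_sum, Fintype.piFinset_univ, Finset.smul_sum, inversion_single]
      refine Finset.sum_congr rfl fun u _ => ?_
      rw [prod_xpow (fun i => (u i : ℤ) * m i), AddMonoidAlgebra.smul_single, smul_eq_mul, mul_one]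
    rw [h]
    exact Subalgebra.smul_mem _ (prod_mem fun i _ => xpow_add_xpow_neg_mem_adjoin i _) r

/-- Symmetric Laurent polynomials are polynomials in the symmetric variables. -/
theorem mem_adjoin_of_mem_symLaurent {f : Laurent} (hf : f ∈ symLaurent) :
    f ∈ Algebra.adjoin GroundField (Set.range xsym) := by
  have h := sum_inversion_mem_adjoin f
  have h8 : (8 : GroundField) ≠ 0 := by norm_num
  -- 8 is the order of the inversion group, invertible in characteristic zero.
  have e : ∑ u : Fin 3 → ℤˣ, inversion u f = (8 : GroundField) • f := by
    rw [Finset.sum_congr rfl fun u _ => hf u, Finset.sum_const, Finset.card_univ,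
      Fintype.card_fun, Fintype.card_units_int, Fintype.card_fin, ← Nat.cast_smul_eq_nsmul GroundField]
    norm_num
  rw [e] at h
  have := Subalgebra.smul_mem _ h (8 : GroundField)⁻¹
  rwa [inv_smul_smul₀ h8] at this

/-! ### The Macdonald polynomials span ℋ, and the knot algebra acts on it. -/

namespace IsGenusTwoMacdonald

variable {Ψ : ℤ → ℤ → ℤ → Laurent}

theorem mem_symLaurent (h : IsGenusTwoMacdonald Ψ) (j₁ j₂ j₃ : ℤ) : Ψ j₁ j₂ j₃ ∈ symLaurent := by
  by_cases hj : Admissible j₁ j₂ j₃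
  swap
  · rw [h.eq_zero _ _ _ hj]
    exact Submodule.zero_mem _
  have key (k₁ k₂ k₃ : ℤ) (c : GroundField) (s : ℤ) (ih : ∀ k₁ k₂ k₃ : ℤ, Admissible k₁ k₂ k₃ →
      k₁ + k₂ + k₃ < s → Ψ k₁ k₂ k₃ ∈ symLaurent) (hs : k₁ + k₂ + k₃ < s) :
      c • Ψ k₁ k₂ k₃ ∈ symLaurent := by
    refine Submodule.smul_mem _ _ ?_
    by_cases hk : Admissible k₁ k₂ k₃
    · exact ih _ _ _ hk hs
    · rw [h.eq_zero _ _ _ hk]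
      exact Submodule.zero_mem _
  refine Admissible.induction (P := fun j₁ j₂ j₃ => Ψ j₁ j₂ j₃ ∈ symLaurent) ?_ ?_ ?_ ?_ hj
  · rw [h.eq_one]
    exact fun u => map_one _
  · intro j₁ j₂ j₃ hj ih
    refine mem_of_pieri_sum_mem symLaurent (j₁ := j₁) (j₂ := j₂) (j₃ := j₃)
      (f := fun a b => Ψ (j₁ + a) (j₂ + b) j₃) ?_
      fun a b ha hb hab => key _ _ _ _ _ ih (by omega)
    rw [← h.pieri₁₂ _ _ _ hj]
    exact xsym_mul_mem_symLaurent 0 (ih _ _ _ hj (by omega))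
  · intro j₁ j₂ j₃ hj ih
    refine mem_of_pieri_sum_mem symLaurent (j₁ := j₁) (j₂ := j₃) (j₃ := j₂)
      (f := fun a b => Ψ (j₁ + a) j₂ (j₃ + b)) ?_
      fun a b ha hb hab => key _ _ _ _ _ ih (by omega)
    rw [← h.pieri₁₃ _ _ _ hj]
    exact xsym_mul_mem_symLaurent 1 (ih _ _ _ hj (by omega))
  · intro j₁ j₂ j₃ hj ih
    refine mem_of_pieri_sum_mem symLaurent (j₁ := j₂) (j₂ := j₃) (j₃ := j₁)
      (f := fun a b => Ψ j₁ (j₂ + a) (j₃ + b)) ?_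
      fun a b ha hb hab => key _ _ _ _ _ ih (by omega)
    rw [← h.pieri₂₃ _ _ _ hj]
    exact xsym_mul_mem_symLaurent 2 (ih _ _ _ hj (by omega))

/-- The span of the genus two Macdonald polynomials. -/
def span (Ψ : ℤ → ℤ → ℤ → Laurent) : Submodule GroundField Laurent :=
  Submodule.span GroundField {f | ∃ j₁ j₂ j₃, f = Ψ j₁ j₂ j₃}

theorem mem_span (Ψ : ℤ → ℤ → ℤ → Laurent) (j₁ j₂ j₃ : ℤ) : Ψ j₁ j₂ j₃ ∈ span Ψ :=
  Submodule.subset_span ⟨j₁, j₂, j₃, rfl⟩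

theorem xsym_mul_mem_span (h : IsGenusTwoMacdonald Ψ) (i : Fin 3) {f : Laurent}
    (hf : f ∈ span Ψ) : xsym i * f ∈ span Ψ := by
  induction hf using Submodule.span_induction with
  | zero => rw [mul_zero]; exact Submodule.zero_mem _
  | add f g _ _ hf hg => rw [mul_add]; exact Submodule.add_mem _ hf hg
  | smul c f _ hf => rw [mul_smul_comm]; exact Submodule.smul_mem _ _ hf
  | mem f hf =>
    obtain ⟨j₁, j₂, j₃, rfl⟩ := hf
    by_cases hj : Admissible j₁ j₂ j₃
    · fin_cases i
      · exact h.pieri₁₂ _ _ _ hj ▸ Submodule.sum_mem _ fun a _ => Submodule.sum_mem _ fun b _ =>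
          Submodule.smul_mem _ _ (mem_span Ψ _ _ _)
      · exact h.pieri₁₃ _ _ _ hj ▸ Submodule.sum_mem _ fun a _ => Submodule.sum_mem _ fun b _ =>
          Submodule.smul_mem _ _ (mem_span Ψ _ _ _)
      · exact h.pieri₂₃ _ _ _ hj ▸ Submodule.sum_mem _ fun a _ => Submodule.sum_mem _ fun b _ =>
          Submodule.smul_mem _ _ (mem_span Ψ _ _ _)
    · rw [h.eq_zero _ _ _ hj, mul_zero]
      exact Submodule.zero_mem _

/-- The genus two Macdonald polynomials span the space of symmetric Laurent polynomials. -/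
theorem symLaurent_le_span (h : IsGenusTwoMacdonald Ψ) : symLaurent ≤ span Ψ := by
  intro f hf
  -- By the Pieri rules the span is an ideal-like module over the subalgebra generated by the X's;
  -- taking g = Ψ₀₀₀ = 1 gives f itself.
  have key : ∀ g ∈ span Ψ, f * g ∈ span Ψ := by
    refine Algebra.adjoin_induction (p := fun f _ => ∀ g ∈ span Ψ, f * g ∈ span Ψ) ?_ ?_ ?_ ?_
      (mem_adjoin_of_mem_symLaurent hf)
    · rintro _ ⟨i, rfl⟩ g hg
      exact h.xsym_mul_mem_span i hg
    · intro r g hg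
      rw [← Algebra.smul_def]
      exact Submodule.smul_mem _ _ hg
    · intro f₁ f₂ _ _ h₁ h₂ g hg
      rw [add_mul]
      exact Submodule.add_mem _ (h₁ g hg) (h₂ g hg)
    · intro f₁ f₂ _ _ h₁ h₂ g hg
      rw [mul_assoc]
      exact h₁ _ (h₂ g hg)
  simpa [h.eq_one] using key _ (mem_span Ψ 0 0 0)

/-- An operator that is diagonal on the genus two Macdonald polynomials acts on the space of
symmetric Laurent polynomials. -/
theorem apply_mem_symRatFun (h : IsGenusTwoMacdonald Ψ) {T : Module.End GroundField RatFun}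
    {c : ℤ → ℤ → ℤ → GroundField}
    (hT : ∀ j₁ j₂ j₃, T (toRatFun (Ψ j₁ j₂ j₃)) = c j₁ j₂ j₃ • toRatFun (Ψ j₁ j₂ j₃))
    {f : RatFun} (hf : f ∈ symRatFun) : T f ∈ symRatFun := by
  obtain ⟨g, hg, rfl⟩ := hf
  have hg' := h.symLaurent_le_span hg
  clear hg
  induction hg' using Submodule.span_induction with
  | zero => rw [map_zero, map_zero]; exact Submodule.zero_mem _
  | add f g _ _ hf hg => rw [map_add, map_add]; exact Submodule.add_mem _ hf hg
  | smul c f _ hf => rw [map_smul, map_smul]; exact Submodule.smul_mem _ _ hf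
  | mem f hf =>
    obtain ⟨j₁, j₂, j₃, rfl⟩ := hf
    rw [AlgHom.toLinearMap_apply, hT]
    exact Submodule.smul_mem _ _ ⟨_, h.mem_symLaurent j₁ j₂ j₃, rfl⟩

theorem opA1_apply (h : IsGenusTwoMacdonald Ψ) (j₁ j₂ j₃ : ℤ) :
    opA1 (toRatFun (Ψ j₁ j₂ j₃)) = eigenvalue j₁ • toRatFun (Ψ j₁ j₂ j₃) :=
  h.pieriFamily.diffOp_eq_smul (by decide) (by decide) (by decide) j₁ j₂ j₃

theorem opA2_apply (h : IsGenusTwoMacdonald Ψ) (j₁ j₂ j₃ : ℤ) :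
    opA2 (toRatFun (Ψ j₁ j₂ j₃)) = eigenvalue j₂ • toRatFun (Ψ j₁ j₂ j₃) :=
  h.pieriFamily.swap₁₂.diffOp_eq_smul (by decide) (by decide) (by decide) j₂ j₁ j₃

theorem opA3_apply (h : IsGenusTwoMacdonald Ψ) (j₁ j₂ j₃ : ℤ) :
    opA3 (toRatFun (Ψ j₁ j₂ j₃)) = eigenvalue j₃ • toRatFun (Ψ j₁ j₂ j₃) :=
  h.pieriFamily.swap₂₃.swap₁₂.diffOp_eq_smul (by decide) (by decide) (by decide) j₃ j₁ j₂

end IsGenusTwoMacdonald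

theorem opB_apply_mem_symRatFun (i : Fin 3) {f : RatFun} (hf : f ∈ symRatFun) :
    opB i f ∈ symRatFun := by
  obtain ⟨g, hg, rfl⟩ := hf
  refine ⟨xsym i * g, xsym_mul_mem_symLaurent i hg, ?_⟩
  rw [AlgHom.toLinearMap_apply, map_mul, toRatFun_xsym]
  rfl

/-- The coefficients of the A operators have denominators, so it is not evident that they preserve
ℋ; this comes from their diagonal action on the spanning family Ψ. -/
theorem knotAlgebra_apply_mem_symRatFun {T : Module.End GroundField RatFun}
    (hT : T ∈ knotAlgebra) : ∀ f ∈ symRatFun, T f ∈ symRatFun := by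
  obtain ⟨Ψ, h⟩ := exists_isGenusTwoMacdonald
  refine Algebra.adjoin_induction (p := fun T _ => ∀ f ∈ symRatFun, T f ∈ symRatFun)
    ?_ ?_ ?_ ?_ hT
  · rintro T (rfl | rfl | rfl | rfl | rfl | rfl) f hf
    · exact h.apply_mem_symRatFun h.opA1_apply hf
    · exact h.apply_mem_symRatFun h.opA2_apply hf
    · exact h.apply_mem_symRatFun h.opA3_apply hf
    · exact opB_apply_mem_symRatFun 0 hf
    · exact opB_apply_mem_symRatFun 1 hf
    · exact opB_apply_mem_symRatFun 2 hf
  · intro r f hf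
    rw [Module.algebraMap_end_apply]
    exact Submodule.smul_mem _ _ hf
  · intro S T _ _ hS hT f hf
    exact Submodule.add_mem _ (hS f hf) (hT f hf)
  · intro S T _ _ hS hT f hf
    exact hS _ (hT f hf)

end GenusTwo
end

theorem mainTheorem2 :
    (∃! Ψ : ℤ → ℤ → ℤ → GenusTwo.Laurent, GenusTwo.IsGenusTwoMacdonald Ψ) ∧
    (∀ Ψ : ℤ → ℤ → ℤ → GenusTwo.Laurent, GenusTwo.IsGenusTwoMacdonald Ψ →
      ∀ j₁ j₂ j₃ : ℤ, GenusTwo.Admissible j₁ j₂ j₃ →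
        Module.End.HasEigenvector GenusTwo.opA1 (GenusTwo.eigenvalue j₁)
          (GenusTwo.toRatFun (Ψ j₁ j₂ j₃)) ∧
        Module.End.HasEigenvector GenusTwo.opA2 (GenusTwo.eigenvalue j₂)
          (GenusTwo.toRatFun (Ψ j₁ j₂ j₃)) ∧
        Module.End.HasEigenvector GenusTwo.opA3 (GenusTwo.eigenvalue j₃)
          (GenusTwo.toRatFun (Ψ j₁ j₂ j₃))) ∧
    (∀ T ∈ GenusTwo.knotAlgebra, ∀ f ∈ GenusTwo.symRatFun, T f ∈ GenusTwo.symRatFun) := by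
  refine ⟨?_, fun Ψ h j₁ j₂ j₃ hj => ?_,
    fun T hT => GenusTwo.knotAlgebra_apply_mem_symRatFun hT⟩
  · obtain ⟨Ψ, h⟩ := GenusTwo.exists_isGenusTwoMacdonald
    exact ⟨Ψ, h, fun Ψ' h' => h'.unique h⟩
  · have hne : GenusTwo.toRatFun (Ψ j₁ j₂ j₃) ≠ 0 :=
      h.pieriFamily.ne_zero (by decide) (by decide) (by decide) hj
    exact ⟨⟨Module.End.mem_eigenspace_iff.2 (h.opA1_apply j₁ j₂ j₃), hne⟩,
      ⟨Module.End.mem_eigenspace_iff.2 (h.opA2_apply j₁ j₂ j₃), hne⟩,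
      ⟨Module.End.mem_eigenspace_iff.2 (h.opA3_apply j₁ j₂ j₃), hne⟩⟩
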